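/- Let $\Omega\subset\mathbb R^2$ be a nonempty compact convex set. Fields bandlimited to $\Omega$ are the (continuous representatives of) functions $f\in L^2(\mathbb R^2)$ whose Fourier transform $F(\omega)=\int f(r)e^{-i\langle\omega,r\rangle}\,dr$ vanishes for almost every $\omega\notin\Omega$. A trajectory set $P$ is a countable collection of differentiable curves $p:\mathbb R\to\mathbb R^2$. Let $\mathcal D^P(a,x)=\sum_{p\in P}\int_{\{t:\|p(t)-x\|\le a\}}\|p'(t)\|\,dt$ be its length inside the disc $B_a(x)$ of radius $a$ about $x$, and let $\ell(P)=\limsup_{a\to\infty}\sup_x \mathcal D^P(a,x)/(\pi a^2)$ be its path density. $P$ is a Nyquist trajectory set for $\Omega$ if (i) there is a uniformly discrete set $\Lambda$ of points on the trajectories of $P$ (i.e. for some $r>0$, distinct points of $\Lambda$ are more than $r$ apart) such that every field bandlimited to $\Omega$ is uniquely determined by its values on $\Lambda$; and (ii) for each $x$ there is a function $h(a)=o(a^2)$ as $a\to\infty$ such that, for all large $a$, the part of $P$ inside $B_a(x)$ is contained in a single continuous curve of length at most $\mathcal D^P(a,x)+h(a)$. A uniform set is a set of equispaced parallel lines $\{w+j\Delta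 v^\perp+tv : j\in\mathbb Z\}$ (parametrised by $t\in\mathbb R$) with $w,v\in\mathbb R^2$, $v\ne0$, $v^\perp$ a unit vector orthogonal to $v$, and spacing $\Delta>0$. Let $\mathcal E_\Omega$ be the collection of Nyquist trajectory sets for $\Omega$ that are unions of finitely many (at least one) uniform sets. For $u\neq 0$ let $B^u(\Omega)$ be the distance between the two supporting lines of $\Omega$ perpendicular to $u$, and let the width of $\Omega$ be $\mathcal W(\Omega)=\min_{u\ne 0}B^u(\Omega)$ (the minimum is attained). Then $$\inf_{Q\in\mathcal E_\Omega}\ell(Q)=\frac{\mathcal W(\Omega)}{2\pi}.$$ Moreover, suppose that $\mathcal W(\Omega)>0$, let $\hat u\neq0$ be any minimizer of $B^u(\Omega)$, let $\hat u^\perp\ne0$ be orthogonal to $\hat u$, and for $\epsilon>0$ let $P^\epsilon=\{p_j^\epsilon: j\in\mathbb Z\}$ with $$p_j^\epsilon(t)=j\left(\frac{2\pi}{\mathcal W(\Omega)}-\epsilon\right)\frac{\hat u}{\|\hat u\|}+t\,\hat u^\perp,\qquad t\in\mathbb R.$$ Then $P^\epsilon\in\mathcal E_\Omega$ for every $\epsilon\in\left(0,\frac{2\pi}{\mathcal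 W(\Omega)}\right)$, and $$\lim_{\epsilon\to0^+}\ell(P^\epsilon)=\inf_{Q\in\mathcal E_\Omega}\ell(Q)=\frac{\mathcal W(\Omega)}{2\pi}.$$ -/

import Mathlib

open MeasureTheory Filter Topology Set
open scoped ENNReal FourierTransform

noncomputable section

/-- The plane `ℝ²` with its Euclidean structure. -/
abbrev Plane : Type := EuclideanSpace ℝ (Fin 2)

/-! ### Bandlimited fields and sampling sets -/

/-- The fields bandlimited to `Ω`: the finite-energy fields `f : ℝ² → ℂ` whose Fourier transform
`F(ω) = ∫ f(r) exp(-i⟨ω, r⟩) dr` (in the `L²` sense) vanishes almost everywhere outside `Ω`.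
Mathlib's transform is `𝓕 f (ξ) = ∫ f(r) exp(-2πi⟨r, ξ⟩) dr`, so `F(2πξ) = 𝓕 f (ξ)`.
A bandlimited class in `L²` is represented by its continuous representative, so that point
samples make sense. -/
def Bandlimited (Ω : Set Plane) : Set (Plane → ℂ) :=
  {f | Continuous f ∧ ∃ hf : MemLp f 2 (volume : Measure Plane),
    ∀ᵐ ξ : Plane, (2 * Real.pi) • ξ ∉ Ω → (𝓕 (hf.toLp f) : Lp ℂ 2 (volume : Measure Plane)) ξ = 0}

/-- Distinct points of `Λ` are at distance more than some fixed `r > 0`. -/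
def UniformlyDiscrete (Λ : Set Plane) : Prop :=
  ∃ r : ℝ, 0 < r ∧ ∀ x ∈ Λ, ∀ y ∈ Λ, x ≠ y → r < ‖x - y‖

/-- Every field bandlimited to `Ω` is uniquely determined by its values on `Λ`. -/
def Determines (Λ Ω : Set Plane) : Prop :=
  ∀ f ∈ Bandlimited Ω, ∀ g ∈ Bandlimited Ω, (∀ x ∈ Λ, f x = g x) → f = g

/-! ### Trajectory sets and path density -/

/-- A trajectory set: a countable collection of (differentiable) parametrised curves
`p : ℝ → ℝ²`. -/
def IsTrajectorySet (P : Set (ℝ → Plane)) : Prop :=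
  P.Countable ∧ ∀ p ∈ P, Differentiable ℝ p

/-- `T(a, x) = {t : ‖p(t) - x‖ ≤ a}`, the times that `p` spends in the closed disc of
radius `a` centred at `x`. -/
def timesIn (p : ℝ → Plane) (a : ℝ) (x : Plane) : Set ℝ :=
  {t | ‖p t - x‖ ≤ a}

/-- Total arc length of the trajectories of `P` inside the closed disc of radius `a` about `x`. -/
def lengthIn (P : Set (ℝ → Plane)) (a : ℝ) (x : Plane) : ℝ≥0∞ :=
  ∑' p : P, ∫⁻ t in timesIn p.1 a x, ENNReal.ofReal ‖deriv p.1 t‖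

/-- Path density: `limsup_{a → ∞} sup_x (length inside the disc) / (area of the disc)`. -/
def pathDensity (P : Set (ℝ → Plane)) : ℝ≥0∞ :=
  limsup (fun a : ℝ =>
    (⨆ x : Plane, lengthIn P a x) / volume (Metric.closedBall (0 : Plane) a)) atTop

/-- The part of the trajectory set `P` inside the closed disc of radius `a` about `x`. -/
def portionIn (P : Set (ℝ → Plane)) (a : ℝ) (x : Plane) : Set Plane :=
  ⋃ p ∈ P, p '' timesIn p a x

/-! ### Nyquist trajectory sets -/

/-- Some uniformly discrete set of points on the trajectories determines all fields
bandlimited to `Ω`. -/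
def NyquistCondition (P : Set (ℝ → Plane)) (Ω : Set Plane) : Prop :=
  ∃ Λ : Set Plane, Λ ⊆ (⋃ p ∈ P, range p) ∧ UniformlyDiscrete Λ ∧ Determines Λ Ω

/-- For each `x` there is `h(a) = o(a²)` such that, for all large `a`, the part of `P` inside the
disc of radius `a` about `x` lies on one continuous curve of length at most
`lengthIn P a x + h(a)`. -/
def NonDegenerate (P : Set (ℝ → Plane)) : Prop :=
  ∀ x : Plane, ∃ h : ℝ → ℝ, h =o[atTop] (fun a : ℝ => a ^ 2) ∧
    ∀ᶠ a : ℝ in atTop, ∃ γ : ℝ → Plane, ContinuousOn γ (Icc 0 1) ∧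
      portionIn P a x ⊆ γ '' Icc 0 1 ∧
      eVariationOn γ (Icc 0 1) ≤ lengthIn P a x + ENNReal.ofReal (h a)

/-- The collection of Nyquist trajectory sets for `Ω`. -/
def NyquistSets (Ω : Set Plane) : Set (Set (ℝ → Plane)) :=
  {P | IsTrajectorySet P ∧ NyquistCondition P Ω ∧ NonDegenerate P}

/-! ### Uniform sets and their unions -/

/-- The lines `p_j(t) = w + jΔ n + t v`, `j ∈ ℤ`. -/
def parallelLines (w n v : Plane) (Δ : ℝ) : Set (ℝ → Plane) :=
  range fun j : ℤ => fun t : ℝ => w + ((j : ℝ) * Δ) • n + t • v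

/-- A uniform set: equispaced parallel lines, `n` being a unit normal to the direction `v`
and `Δ > 0` the spacing. -/
def IsUniformSet (P : Set (ℝ → Plane)) : Prop :=
  ∃ (w n v : Plane) (Δ : ℝ), v ≠ 0 ∧ ‖n‖ = 1 ∧ inner ℝ n v = 0 ∧ 0 < Δ ∧
    P = parallelLines w n v Δ

/-- The Nyquist trajectory sets for `Ω` that are finite unions of uniform sets. -/
def NyquistUniformUnions (Ω : Set Plane) : Set (Set (ℝ → Plane)) :=
  {Q | Q ∈ NyquistSets Ω ∧ ∃ (N : ℕ) (P : Fin N → Set (ℝ → Plane)),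
    0 < N ∧ (∀ i, IsUniformSet (P i)) ∧ Q = ⋃ i, P i}

/-! ### Breadth and width -/

/-- The breadth of `Ω` in the direction `u ≠ 0`: the distance between the two supporting lines
`⟪u, ω⟫ = max` and `⟪u, ω⟫ = min` of `Ω` that are perpendicular to `u`. -/
def breadth (Ω : Set Plane) (u : Plane) : ℝ :=
  (sSup ((fun ω => inner ℝ u ω) '' Ω) - sInf ((fun ω => inner ℝ u ω) '' Ω)) / ‖u‖

/-- The width of `Ω`: the least breadth over all directions `u ≠ 0`. -/
def width (Ω : Set Plane) : ℝ :=
  sInf (breadth Ω '' {u | u ≠ 0})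

/-- The vector `u ≠ 0` is a direction in which `Ω` is narrowest. -/
def IsMinimalDirection (Ω : Set Plane) (u : Plane) : Prop :=
  u ≠ 0 ∧ ∀ u' : Plane, u' ≠ 0 → breadth Ω u ≤ breadth Ω u'

/-- The uniform set of lines `p_j(t) = j (2π / width Ω - ε) u / ‖u‖ + t v`, `j ∈ ℤ`. -/
def narrowLines (Ω : Set Plane) (u v : Plane) (ε : ℝ) : Set (ℝ → Plane) :=
  parallelLines 0 (‖u‖⁻¹ • u) v (2 * Real.pi / width Ω - ε)

end

noncomputable section

/-! Write `W` for the width.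

Upper bound: lines across a narrowest direction, with spacing `Δ < 2π / W`, have density `1 / Δ`,
because sums of chords compare with the area of a disc. Sample them on a fine rectangular lattice.
As the breadth across the lines times `Δ` is below `2π`, the exponentials attached to the lattice
separate the points of the band. They form a group, so by Stone–Weierstrass their span is dense in
the continuous functions on the band, and an integrable spectrum annihilated by all of them is zero
(`determines_of_separates`). Running through the chords of a disc back and forth costs only
`O(a^(3/2))` in connections (`LineFamily.nonDegenerate_curves`).

Lower bound: let families with bases `wᵢ`, unit normals `nᵢ` and spacings `Δᵢ` satisfy `∑ 1/Δᵢ < W /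
2π`, and put `sᵢ = (2π/Δᵢ) nᵢ`. The factor `1 - exp(i⟨sᵢ, x - wᵢ⟩)` vanishes on every line of family
`i`, so the product of these factors with any `g` vanishes on all the lines; its spectrum lies in
the translates of that of `g` by partial sums of the `sᵢ`. Every vector no longer than `W` is a
difference of two points of `Ω` (`exists_chord_of_norm_le_width`), so `sᵢ = μᵢ (bᵢ - aᵢ)` with `aᵢ,
bᵢ ∈ Ω`, `μᵢ = ‖sᵢ‖ / W` and `∑ μᵢ < 1`. By convexity all these translates of `∑ μᵢ aᵢ + (1 - ∑ μᵢ)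
Ω` stay in `Ω`, which leaves room for a nonzero `g` (`exists_bandlimited_vanishing`).

Curves common to several families count once in the density of a union.
`exists_isEssentiallyDisjointUnion` re-cuts the union into families whose overlap has length only
`O(a)` in a disc of radius `a`, so that densities add. -/

/-! ### Bandlimited functions as Fourier integrals -/

theorem continuous_neg_innerₗ : Continuous fun p : Plane × Plane => (-innerₗ Plane) p.1 p.2 := by
  have h : Continuous fun p : Plane × Plane => -inner ℝ p.1 p.2 := by fun_prop
  exact h

theorem continuous_fourierInv_of_integrable {F : Plane → ℂ} (hF : Integrable F) :
    Continuous (𝓕⁻ F) :=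
  VectorFourier.fourierIntegral_continuous Real.continuous_fourierChar continuous_neg_innerₗ hF

/-- On `L¹ ∩ L²`, the `L²` inverse Fourier transform is given by the inverse Fourier integral. -/
theorem fourierInv_ae_eq_of_integrable (F : Lp ℂ 2 (volume : Measure Plane))
    (hF : Integrable F) :
    ((𝓕⁻ F : Lp ℂ 2 (volume : Measure Plane)) : Plane → ℂ) =ᵐ[volume] 𝓕⁻ (F : Plane → ℂ) := by
  have hcont : Continuous (𝓕⁻ (F : Plane → ℂ)) :=
    continuous_fourierInv_of_integrable hF
  refine ae_eq_of_integral_contDiff_smul_eq ((Lp.memLp _).locallyIntegrable (by norm_num))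
    hcont.locallyIntegrable fun g hg hgc => ?_
  have hg₁ : HasCompactSupport (Complex.ofRealCLM ∘ g) := hgc.comp_left rfl
  have hg₂ : ContDiff ℝ (⊤ : ℕ∞) (Complex.ofRealCLM ∘ g) := by fun_prop
  set φ := hg₁.toSchwartzMap hg₂
  have hφ : ∀ x, φ x = (g x : ℂ) := fun x => rfl
  -- The `L²` transform is compatible with that of tempered distributions, so both sides can be
  -- tested by moving the inverse transform onto `φ`.
  have h1 := congrArg (fun T => T φ) (Lp.fourierInv_toTemperedDistribution_eq F)
  simp only [TemperedDistribution.fourierInv_apply, Lp.toTemperedDistribution_apply, hφ] at h1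
  have h2 : ∫ x, (𝓕⁻ φ) x • F x = ∫ x, φ x • (𝓕⁻ (F : Plane → ℂ)) x := by
    have := VectorFourier.integral_fourierIntegral_smul_eq_flip (μ := (volume : Measure Plane))
      (ν := (volume : Measure Plane)) (L := -innerₗ Plane) (f := φ) (g := F)
      Real.continuous_fourierChar
      continuous_neg_innerₗ φ.integrable hF
    have hflip : (-innerₗ Plane).flip = -innerₗ Plane := by
      ext x y; simp [real_inner_comm]
    rw [hflip] at this
    rw [SchwartzMap.fourierInv_coe]
    exact this
  rw [h2] at h1
  simpa [hφ] using h1.symm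

/-- A function bandlimited to a compact set is the inverse Fourier integral of an integrable
function vanishing off the band. -/
theorem Bandlimited.exists_eq_fourierInv {Ω : Set Plane} (hΩ : IsCompact Ω) {f : Plane → ℂ}
    (hf : f ∈ Bandlimited Ω) :
    ∃ F : Plane → ℂ, Integrable F ∧ (∀ᵐ ξ : Plane, (2 * Real.pi) • ξ ∉ Ω → F ξ = 0) ∧
      f = 𝓕⁻ F := by
  obtain ⟨hfc, hf2, hF⟩ := hf
  set F := (𝓕 (hf2.toLp f) : Lp ℂ 2 (volume : Measure Plane)) with hFdef
  have hpi : (2 * Real.pi) ≠ 0 := by positivity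
  have hK : IsCompact ((fun ξ : Plane => (2 * Real.pi) • ξ) ⁻¹' Ω) :=
    (Homeomorph.smulOfNeZero (2 * Real.pi) hpi).isCompact_preimage.2 hΩ
  have hint : Integrable F := by
    have h1 : IntegrableOn F ((fun ξ : Plane => (2 * Real.pi) • ξ) ⁻¹' Ω) :=
      ((Lp.memLp F).locallyIntegrable (by norm_num)).integrableOn_isCompact hK
    refine h1.integrable_of_ae_notMem_eq_zero ?_
    filter_upwards [hF] with ξ h using h
  refine ⟨F, hint, hF, ?_⟩
  have hcont : Continuous (𝓕⁻ (F : Plane → ℂ)) :=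
    continuous_fourierInv_of_integrable hint
  refine (hfc.ae_eq_iff_eq volume hcont).1 ?_
  have h2 := fourierInv_ae_eq_of_integrable F hint
  rw [hFdef, FourierTransform.fourierInv_fourier_eq] at h2
  exact hf2.coeFn_toLp.symm.trans h2

theorem Bandlimited.sub {Ω : Set Plane} {f g : Plane → ℂ} (hf : f ∈ Bandlimited Ω)
    (hg : g ∈ Bandlimited Ω) : f - g ∈ Bandlimited Ω := by
  obtain ⟨hfc, hf2, hF⟩ := hf
  obtain ⟨hgc, hg2, hG⟩ := hg
  refine ⟨hfc.sub hgc, hf2.sub hg2, ?_⟩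
  have h : (𝓕 ((hf2.sub hg2).toLp (f - g)) : Lp ℂ 2 (volume : Measure Plane)) =
      𝓕 (hf2.toLp f) - 𝓕 (hg2.toLp g) := by
    rw [MemLp.toLp_sub]
    exact (Lp.fourierTransformₗᵢ Plane ℂ).map_sub _ _
  rw [h]
  filter_upwards [hF, hG, Lp.coeFn_sub (𝓕 (hf2.toLp f) : Lp ℂ 2 (volume : Measure Plane))
    (𝓕 (hg2.toLp g))] with ξ h1 h2 h3 h4
  rw [h3, Pi.sub_apply, h1 h4, h2 h4, sub_zero]

theorem Bandlimited.zero_mem (Ω : Set Plane) : (0 : Plane → ℂ) ∈ Bandlimited Ω := by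
  refine ⟨continuous_zero, MemLp.zero', ?_⟩
  have h : (𝓕 ((MemLp.zero' : MemLp (0 : Plane → ℂ) 2 volume).toLp 0) :
      Lp ℂ 2 (volume : Measure Plane)) = 0 := by
    rw [MemLp.toLp_zero]
    exact (Lp.fourierTransformₗᵢ Plane ℂ).map_zero
  rw [h]
  filter_upwards [Lp.coeFn_zero ℂ 2 (volume : Measure Plane)] with ξ h1 _
  rw [h1, Pi.zero_apply]

/-! ### Uniqueness from samples on a group -/

/-- The exponential `ξ ↦ exp (2πi⟨ξ, x⟩)` on a set of frequencies. -/
def expOn (K : Set Plane) (x : Plane) : C(K, ℂ) where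
  toFun ξ := Real.fourierChar (inner ℝ (ξ : Plane) x)
  continuous_toFun := by fun_prop

theorem expOn_apply (K : Set Plane) (x : Plane) (ξ : K) :
    expOn K x ξ = Real.fourierChar (inner ℝ (ξ : Plane) x) := rfl

/-- If the exponentials with frequencies in a group separate the points of a compact set, they span
a dense subspace of its continuous functions. -/
theorem span_expOn_topologicalClosure_eq_top {K : Set Plane} [CompactSpace K]
    (Λ : AddSubgroup Plane)
    (hsep : ∀ ξ ∈ K, ∀ η ∈ K, ξ ≠ η → ∃ x ∈ Λ,
      Real.fourierChar (inner ℝ ξ x) ≠ Real.fourierChar (inner ℝ η x)) :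
    (Submodule.span ℂ (expOn K '' Λ)).topologicalClosure = ⊤ := by
  -- Because `Λ` is a group, the exponentials are closed under conjugation and products: their
  -- linear span is already a star subalgebra, and Stone–Weierstrass applies.
  have hstar : ∀ x, star (expOn K x) = expOn K (-x) := by
    intro x; ext ξ
    simp [expOn_apply, inner_neg_right, AddChar.map_neg_eq_inv]
  have hmul : ∀ x y, expOn K x * expOn K y = expOn K (x + y) := by
    intro x y; ext ξ
    simp [expOn_apply, inner_add_right, AddChar.map_add_eq_mul]
  let A : StarSubalgebra ℂ C(K, ℂ) :=
    { toSubalgebra := Algebra.adjoin ℂ (expOn K '' Λ)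
      star_mem' := by
        change Algebra.adjoin ℂ (expOn K '' Λ) ≤ star (Algebra.adjoin ℂ (expOn K '' Λ))
        refine Algebra.adjoin_le ?_
        rintro - ⟨x, hx, rfl⟩
        exact Algebra.subset_adjoin ⟨-x, Λ.neg_mem hx, (hstar x).symm⟩ }
  have hspan : A.toSubalgebra.toSubmodule = Submodule.span ℂ (expOn K '' Λ) := by
    apply Algebra.adjoin_eq_span_of_subset
    refine .trans (fun x ↦ Submonoid.closure_induction (fun _ ↦ id) ⟨0, Λ.zero_mem, ?_⟩ ?_)
      Submodule.subset_span
    · ext ξ; simp [expOn_apply]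
    · rintro _ _ _ _ ⟨x, hx, rfl⟩ ⟨y, hy, rfl⟩
      exact ⟨x + y, Λ.add_mem hx hy, (hmul x y).symm⟩
  have hA : A.SeparatesPoints := by
    intro ξ η hne
    obtain ⟨x, hx, h⟩ := hsep ξ ξ.2 η η.2 (fun h => hne (Subtype.ext h))
    refine ⟨_, ⟨expOn K x, Algebra.subset_adjoin ⟨x, hx, rfl⟩, rfl⟩, ?_⟩
    intro h'
    exact h (Subtype.ext h')
  rw [← hspan]
  exact congrArg (fun B : StarSubalgebra ℂ C(K, ℂ) => Subalgebra.toSubmodule B.toSubalgebra)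
    (ContinuousMap.starSubalgebra_topologicalClosure_eq_top_of_separatesPoints A hA)

/-- A group of sampling points whose exponentials separate the points of the band determines all
bandlimited functions. -/
theorem determines_of_separates {Ω : Set Plane} (hΩ : IsCompact Ω) (Λ : AddSubgroup Plane)
    (hsep : ∀ ω ∈ Ω, ∀ η ∈ Ω, ω ≠ η → ∃ x ∈ Λ,
      Real.fourierChar (inner ℝ ((2 * Real.pi)⁻¹ • ω) x) ≠
        Real.fourierChar (inner ℝ ((2 * Real.pi)⁻¹ • η) x)) :
    Determines (Λ : Set Plane) Ω := by
  intro f hf g hg hfg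
  obtain ⟨F, hFi, hF0, hF⟩ := Bandlimited.exists_eq_fourierInv hΩ (Bandlimited.sub hf hg)
  suffices h : F =ᵐ[volume] 0 by
    rw [← sub_eq_zero, hF]
    ext x
    rw [Real.fourierInv_congr_ae h]
    simp [Real.fourierInv_eq]
  have hpi : (2 * Real.pi) ≠ 0 := by positivity
  set K := (fun ξ : Plane => (2 * Real.pi) • ξ) ⁻¹' Ω with hKdef
  have hK : IsCompact K := (Homeomorph.smulOfNeZero (2 * Real.pi) hpi).isCompact_preimage.2 hΩ
  have : CompactSpace K := isCompact_iff_compactSpace.1 hK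
  let _ : MeasureSpace K := Measure.Subtype.measureSpace
  have hFK : Integrable (fun ξ : K => F ξ) :=
    (integrableOn_iff_comap_subtypeVal hK.measurableSet).1 hFi.integrableOn
  have hint : ∀ φ : C(K, ℂ), Integrable (fun ξ : K => F ξ * φ ξ) := fun φ =>
    hFK.mul_bdd (c := ‖φ‖) φ.continuous.aestronglyMeasurable
      (Eventually.of_forall fun ξ => φ.norm_coe_le_norm ξ)
  -- Integration against the spectrum `F` is a continuous functional whose value at `expOn K x` is
  -- the sample `(f - g) x`. It therefore vanishes on a dense subspace, hence on every test
  -- function.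
  let L : C(K, ℂ) →L[ℂ] ℂ := LinearMap.mkContinuous
    { toFun := fun φ => ∫ ξ : K, F ξ * φ ξ
      map_add' := fun φ ψ => by
        simp only [ContinuousMap.add_apply, mul_add]
        exact integral_add (hint φ) (hint ψ)
      map_smul' := fun c φ => by
        simp only [ContinuousMap.smul_apply, smul_eq_mul, RingHom.id_apply, mul_left_comm _ c]
        exact integral_const_mul _ _ }
    (∫ ξ : K, ‖F ξ‖) (fun φ => by
      rw [← integral_mul_const]
      refine (norm_integral_le_integral_norm _).trans
        (integral_mono (hint φ).norm (hFK.norm.mul_const _) fun ξ => ?_)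
      simp only [norm_mul]
      gcongr
      exact φ.norm_coe_le_norm ξ)
  have hL : ∀ φ, L φ = ∫ ξ : K, F ξ * φ ξ := fun φ => rfl
  have hcompl : ∀ G : Plane → ℂ, ∫ ξ : K, F ξ * G ξ = ∫ ξ, F ξ * G ξ := by
    intro G
    refine (integral_subtype_comap hK.measurableSet (fun ξ => F ξ * G ξ)).trans ?_
    refine setIntegral_eq_integral_of_ae_compl_eq_zero ?_
    filter_upwards [hF0] with ξ h h'
    rw [h h', zero_mul]
  have hspan : Submodule.span ℂ (expOn K '' Λ) ≤ L.toLinearMap.ker := by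
    rw [Submodule.span_le]
    rintro - ⟨x, hx, rfl⟩
    change L (expOn K x) = 0
    have h0 : (f - g) x = 0 := by simp [hfg x hx]
    rw [hF, Real.fourierInv_eq] at h0
    rw [hL, ← h0]
    refine (hcompl fun ξ => Real.fourierChar (inner ℝ ξ x)).trans (integral_congr_ae ?_)
    refine Eventually.of_forall fun ξ => ?_
    simp [Circle.smul_def, mul_comm]
  have hclosure : L.toLinearMap.ker = ⊤ := by
    rw [eq_top_iff, ← span_expOn_topologicalClosure_eq_top (K := K) Λ]
    · exact Submodule.topologicalClosure_minimal _ hspan L.isClosed_ker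
    · intro ξ hξ η hη hne
      obtain ⟨x, hx, h⟩ := hsep _ hξ _ hη (fun h => hne (smul_right_injective _ hpi h))
      refine ⟨x, hx, ?_⟩
      simpa only [smul_smul, inv_mul_cancel₀ hpi, one_smul] using h
  refine ae_eq_zero_of_integral_contDiff_smul_eq_zero hFi.locallyIntegrable fun g hg _ => ?_
  have h1 : L ⟨fun ξ : K => (g ξ : ℂ), by have := hg.continuous; fun_prop⟩ = 0 := by
    change _ ∈ L.toLinearMap.ker
    rw [hclosure]; trivial
  rw [hL] at h1
  rw [← h1]
  refine Eq.trans ?_ (hcompl fun ξ => (g ξ : ℂ)).symm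
  simp [mul_comm]

/-! ### Bandlimited functions vanishing on prescribed lines -/

open SchwartzMap in
/-- The inverse Fourier transform of a Schwartz function supported in the band is bandlimited. -/
theorem fourierInv_mem_bandlimited {Ω : Set Plane} (F : 𝓢(Plane, ℂ))
    (hF : ∀ ξ, (2 * Real.pi) • ξ ∉ Ω → F ξ = 0) : ⇑(𝓕⁻ F : 𝓢(Plane, ℂ)) ∈ Bandlimited Ω := by
  refine ⟨(𝓕⁻ F : 𝓢(Plane, ℂ)).continuous, (𝓕⁻ F : 𝓢(Plane, ℂ)).memLp 2, ?_⟩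
  have h : (𝓕 (((𝓕⁻ F : 𝓢(Plane, ℂ)).memLp 2).toLp ⇑(𝓕⁻ F : 𝓢(Plane, ℂ))) :
      Lp ℂ 2 (volume : Measure Plane)) =
      F.toLp 2 := by
    have := SchwartzMap.toLp_fourier_eq (𝓕⁻ F : 𝓢(Plane, ℂ))
    rw [FourierTransform.fourier_fourierInv_eq] at this
    exact this
  rw [h]
  filter_upwards [F.coeFn_toLp 2] with ξ h1 h2
  rw [h1, hF ξ h2]

open SchwartzMap in
theorem fourierInv_compSubConst (F : 𝓢(Plane, ℂ)) (σ x : Plane) :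
    𝓕⁻ (F.compSubConstCLM ℂ σ) x = Real.fourierChar (inner ℝ σ x) * 𝓕⁻ F x := by
  simp only [SchwartzMap.fourierInv_coe, Real.fourierInv_eq]
  rw [← integral_const_mul]
  refine Eq.trans ?_ (integral_sub_right_eq_self
    (fun v => (Real.fourierChar (inner ℝ σ x) : ℂ) * (Real.fourierChar (inner ℝ v x) • F v)) σ)
  refine integral_congr_ae (Eventually.of_forall fun v => ?_)
  have h : inner ℝ v x = inner ℝ σ x + inner ℝ (v - σ) x := by rw [inner_sub_left]; ring
  simp [h, AddChar.map_add_eq_mul, Circle.smul_def, mul_assoc]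

/-- Otherwise the character would be `1` on a short segment in direction `σ` around a point where `g
≠ 0`, yet its derivative along `σ` is a nonzero multiple of `‖σ‖²`. This keeps the product of `g`
with `1 - character` from being identically zero. -/
theorem exists_fourierChar_ne_one {g : Plane → ℂ} (hg : Continuous g) (hne : ∃ x, g x ≠ 0)
    {σ : Plane} (hσ : σ ≠ 0) (w : Plane) :
    ∃ x, g x ≠ 0 ∧ (Real.fourierChar (inner ℝ σ (x - w)) : ℂ) ≠ 1 := by
  obtain ⟨x₀, hx₀⟩ := hne
  by_contra! hcon
  have hc : Continuous fun t : ℝ => g (x₀ + t • σ) := by fun_prop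
  have hev : ∀ᶠ t : ℝ in 𝓝 0, g (x₀ + t • σ) ≠ 0 :=
    hc.continuousAt.eventually_ne (by simpa using hx₀)
  set β : ℝ := inner ℝ σ σ
  set α : ℝ := inner ℝ σ (x₀ - w)
  have hβ : β ≠ 0 := by simpa [β] using hσ
  have hd : HasDerivAt (fun t : ℝ => Complex.exp ((2 * Real.pi * (α + t * β) : ℂ) * Complex.I))
      (Complex.exp ((2 * Real.pi * (α + (0 : ℝ) * β) : ℂ) * Complex.I) *
        ((2 * Real.pi * (1 * β) : ℂ) * Complex.I)) 0 := by
    have h1 : HasDerivAt (fun t : ℝ => (t : ℂ)) 1 0 := Complex.ofRealCLM.hasDerivAt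
    exact (((((h1.mul_const _).const_add _).const_mul _).mul_const _)).cexp
  have hd' : HasDerivAt (fun t : ℝ => Complex.exp ((2 * Real.pi * (α + t * β) : ℂ) * Complex.I))
      0 0 := by
    refine (hasDerivAt_const (0 : ℝ) (1 : ℂ)).congr_of_eventuallyEq ?_
    filter_upwards [hev] with t ht
    rw [← hcon _ ht, Real.fourierChar_apply, add_sub_right_comm, inner_add_right, inner_smul_right]
    push_cast
    rfl
  have h := hd.unique hd'
  simp [Complex.exp_ne_zero, hβ, Real.pi_ne_zero] at h

open SchwartzMap in
/-- Multiplying a bandlimited function by `1 - exp (i⟨s, x - w⟩)`. -/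
theorem exists_schwartz_mul_one_sub_fourierChar {K Ω : Set Plane} {s : Plane} (hs : s ≠ 0)
    (w : Plane) (hK : K ⊆ Ω) (hKs : ∀ ω ∈ K, ω + s ∈ Ω) (F : 𝓢(Plane, ℂ))
    (hF : ∀ ξ, (2 * Real.pi) • ξ ∉ K → F ξ = 0) (hne : ∃ x, 𝓕⁻ F x ≠ 0) :
    ∃ G : 𝓢(Plane, ℂ), (∀ ξ, (2 * Real.pi) • ξ ∉ Ω → G ξ = 0) ∧ (∃ x, 𝓕⁻ G x ≠ 0) ∧
      ∀ x, 𝓕⁻ G x =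
        (1 - Real.fourierChar (inner ℝ ((2 * Real.pi)⁻¹ • s) (x - w))) * 𝓕⁻ F x := by
  have hpi : (2 * Real.pi) ≠ 0 := by positivity
  set σ := (2 * Real.pi)⁻¹ • s with hσ
  set c : ℂ := (Real.fourierChar (inner ℝ σ (-w)) : ℂ) with hc
  -- Multiplication by the character of `σ` translates the spectrum by `σ`; the constant `c` makes
  -- the phase vanish at `w`.
  let G : 𝓢(Plane, ℂ) := F - c • F.compSubConstCLM ℂ σ
  have hG : ∀ x, 𝓕⁻ G x = (1 - Real.fourierChar (inner ℝ σ (x - w))) * 𝓕⁻ F x := by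
    intro x
    have h1 : 𝓕⁻ G = 𝓕⁻ F - c • 𝓕⁻ (F.compSubConstCLM ℂ σ) := by
      rw [show G = F + -(c • F.compSubConstCLM ℂ σ) from sub_eq_add_neg _ _,
        FourierTransform.fourierInv_add, FourierTransform.fourierInv_neg, ← sub_eq_add_neg,
        FourierTransform.fourierInv_smul]
    rw [h1, _root_.sub_apply, _root_.smul_apply, fourierInv_compSubConst, sub_eq_add_neg x,
      inner_add_right, AddChar.map_add_eq_mul]
    simp only [smul_eq_mul, Circle.coe_mul, hc]
    ring
  refine ⟨G, fun ξ hξ => ?_, ?_, hG⟩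
  · have h1 : F ξ = 0 := hF ξ fun h => hξ (hK h)
    have h2 : F (ξ - σ) = 0 := hF _ fun h => hξ (by
      have := hKs _ h
      rwa [smul_sub, hσ, smul_smul, mul_inv_cancel₀ hpi, one_smul, sub_add_cancel] at this)
    simp [G, h1, h2]
  · obtain ⟨x, hx, hx'⟩ := exists_fourierChar_ne_one (𝓕⁻ F).continuous hne
      (σ := σ) (smul_ne_zero (inv_ne_zero hpi) hs) w
    exact ⟨x, by rw [hG]; exact mul_ne_zero (sub_ne_zero.2 hx'.symm) hx⟩

open SchwartzMap in
theorem exists_schwartz_of_interior_nonempty {Ω : Set Plane} (hΩ : (interior Ω).Nonempty) :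
    ∃ F : 𝓢(Plane, ℂ), (∀ ξ, (2 * Real.pi) • ξ ∉ Ω → F ξ = 0) ∧ ∃ x, 𝓕⁻ F x ≠ 0 := by
  obtain ⟨ω, hω⟩ := hΩ
  have hpi : (2 * Real.pi) ≠ 0 := by positivity
  set ξ₀ := (2 * Real.pi)⁻¹ • ω with hξ₀
  have hnhds : (fun ξ : Plane => (2 * Real.pi) • ξ) ⁻¹' Ω ∈ 𝓝 ξ₀ := by
    refine (continuous_const_smul (2 * Real.pi)).continuousAt.preimage_mem_nhds ?_
    rw [hξ₀, smul_smul, mul_inv_cancel₀ hpi, one_smul]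
    exact mem_interior_iff_mem_nhds.1 hω
  obtain ⟨g, hg, hgc, hgd, -, hg1⟩ := exists_contDiff_tsupport_subset (n := ⊤) hnhds
  have h1 : HasCompactSupport (Complex.ofRealCLM ∘ g) := hgc.comp_left rfl
  have h2 : ContDiff ℝ (⊤ : ℕ∞) (Complex.ofRealCLM ∘ g) := by fun_prop
  refine ⟨h1.toSchwartzMap h2, fun ξ hξ => ?_, ?_⟩
  · have : g ξ = 0 := by
      by_contra h
      exact hξ (hg (subset_tsupport g h))
    simp [this]
  · by_contra! h
    have h0 : (𝓕⁻ (h1.toSchwartzMap h2) : 𝓢(Plane, ℂ)) = 0 := by ext x; exact h x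
    have h3 : h1.toSchwartzMap h2 = 0 := by
      rw [← FourierTransform.fourier_fourierInv_eq (F := 𝓢(Plane, ℂ)) (h1.toSchwartzMap h2), h0]
      exact FourierTransform.fourier_zero ..
    have h4 := congrArg (fun φ : 𝓢(Plane, ℂ) => φ ξ₀) h3
    simp [hg1] at h4

/-- If every vector of length at most `W` is a difference of two points of the convex band `Ω`,
then some nonzero bandlimited function vanishes wherever one of the phases `⟨s, x - w⟩` is a
multiple of `2π`, as soon as the lengths of the `s` add up to less than `W`. -/
theorem exists_bandlimited_vanishing {Ω : Set Plane} (hconv : Convex ℝ Ω)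
    (hint : (interior Ω).Nonempty) {W : ℝ} (hW : 0 < W)
    (hchord : ∀ s : Plane, ‖s‖ ≤ W → ∃ a ∈ Ω, a + s ∈ Ω) (l : List (Plane × Plane))
    (hl : ∀ p ∈ l, p.1 ≠ 0) (hsum : (l.map fun p => ‖p.1‖).sum < W) :
    ∃ f ∈ Bandlimited Ω, f ≠ 0 ∧ ∀ p ∈ l, ∀ x,
      (Real.fourierChar (inner ℝ ((2 * Real.pi)⁻¹ • p.1) (x - p.2)) : ℂ) = 1 → f x = 0 := by
  -- The induction runs over homothetic copies `c + ρ Ω` of the band: each factor uses up `‖s‖ / W`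
  -- of the ratio `ρ`.
  suffices h : ∀ (c : Plane) (ρ : ℝ), 0 < ρ → (l.map fun p => ‖p.1‖).sum < ρ * W →
      ∃ F : SchwartzMap Plane ℂ,
        (∀ ξ, (2 * Real.pi) • ξ ∉ (fun ω => c + ρ • ω) '' Ω → F ξ = 0) ∧ (∃ x, 𝓕⁻ F x ≠ 0) ∧
        ∀ p ∈ l, ∀ x, (Real.fourierChar (inner ℝ ((2 * Real.pi)⁻¹ • p.1) (x - p.2)) : ℂ) = 1 →
          𝓕⁻ F x = 0 by
    obtain ⟨F, hF, ⟨x, hx⟩, hv⟩ := h 0 1 one_pos (by simpa using hsum)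
    exact ⟨_, fourierInv_mem_bandlimited F (by simpa using hF), fun h => hx (congrFun h x), hv⟩
  clear hsum
  induction l with
  | nil =>
    intro c ρ hρ _
    have hi : (interior ((fun ω => c + ρ • ω) '' Ω)).Nonempty := by
      have : (fun ω => c + ρ • ω) '' Ω =
          ((Homeomorph.smulOfNeZero ρ hρ.ne').trans (Homeomorph.addLeft c)) '' Ω := rfl
      rw [this, ← Homeomorph.image_interior]
      exact hint.image _
    obtain ⟨F, h1, h2⟩ := exists_schwartz_of_interior_nonempty hi
    exact ⟨F, h1, h2, by simp⟩
  | cons q l ih =>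
    intro c ρ hρ hsum
    obtain ⟨s, w⟩ := q
    have hs : s ≠ 0 := hl (s, w) (by simp)
    have hs' : 0 < ‖s‖ := norm_pos_iff.2 hs
    simp only [List.map_cons, List.sum_cons] at hsum
    have hnn : 0 ≤ (l.map fun p => ‖p.1‖).sum := List.sum_nonneg fun y hy => by
      obtain ⟨p, -, rfl⟩ := List.mem_map.1 hy
      exact norm_nonneg _
    obtain ⟨a, ha, hat⟩ := hchord ((W / ‖s‖) • s) (by
      rw [norm_smul, Real.norm_of_nonneg (by positivity), div_mul_cancel₀ _ hs'.ne'])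
    set μ := ‖s‖ / W with hμ
    have hμ0 : 0 < μ := by positivity
    have hμW : μ * W = ‖s‖ := div_mul_cancel₀ _ hW.ne'
    have hμρ : μ < ρ := by
      refine lt_of_mul_lt_mul_right ?_ hW.le
      linarith
    have hμs : μ • ((W / ‖s‖) • s) = s := by
      rw [smul_smul, hμ, div_mul_div_cancel₀ hW.ne', div_self hs'.ne', one_smul]
    -- Applied to both ends `b` of a chord of length `W` parallel to `s`: the copy of ratio `ρ - μ`
    -- and its translate by `s = μ • (chord)` both lie in `c + ρ Ω`.
    have key : ∀ b ∈ Ω, ∀ ω ∈ Ω, c + μ • b + (ρ - μ) • ω ∈ (fun ω => c + ρ • ω) '' Ω := by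
      intro b hb ω hω
      refine ⟨(μ / ρ) • b + ((ρ - μ) / ρ) • ω, hconv hb hω (by positivity)
        (div_nonneg (by linarith) hρ.le) (by field_simp; ring), ?_⟩
      simp only [smul_add, smul_smul, mul_div_cancel₀ _ hρ.ne', add_assoc]
    obtain ⟨F, hF, hne, hv⟩ := ih (fun p hp => hl p (by simp [hp])) (c + μ • a) (ρ - μ)
      (by linarith) (by rw [sub_mul, hμW]; linarith)
    obtain ⟨G, hG, hGne, hGF⟩ := exists_schwartz_mul_one_sub_fourierChar hs w
      (K := (fun ω => c + μ • a + (ρ - μ) • ω) '' Ω) (Ω := (fun ω => c + ρ • ω) '' Ω)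
      (by rintro - ⟨ω, hω, rfl⟩; exact key a ha ω hω)
      (by
        rintro - ⟨ω, hω, rfl⟩
        have := key _ hat ω hω
        rw [smul_add, hμs] at this
        convert this using 1
        simp only []
        abel) F hF hne
    refine ⟨G, hG, hGne, fun p hp x hx => ?_⟩
    rw [hGF]
    rcases List.mem_cons.1 hp with rfl | hp
    · rw [hx, sub_self, zero_mul]
    · rw [hv p hp x hx, mul_zero]

/-! ### Breadth, width and chords -/

theorem exists_breadth_eq {Ω : Set Plane} (hne : Ω.Nonempty) (hcomp : IsCompact Ω) (u : Plane) :
    ∃ ω ∈ Ω, ∃ η ∈ Ω, breadth Ω u = inner ℝ u (ω - η) / ‖u‖ ∧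
      (∀ x ∈ Ω, inner ℝ u x ≤ inner ℝ u ω) ∧ ∀ x ∈ Ω, inner ℝ u η ≤ inner ℝ u x := by
  have hc : ContinuousOn (fun ω => inner ℝ u ω) Ω := by fun_prop
  obtain ⟨ω, hω, h1, h1'⟩ := hcomp.exists_sSup_image_eq_and_ge hne hc
  obtain ⟨η, hη, h2, h2'⟩ := hcomp.exists_sInf_image_eq_and_le hne hc
  exact ⟨ω, hω, η, hη, by rw [breadth, h1, h2, inner_sub_right], h1', h2'⟩

theorem inner_sub_le_breadth {Ω : Set Plane} (hcomp : IsCompact Ω) (u : Plane) {x y : Plane}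
    (hx : x ∈ Ω) (hy : y ∈ Ω) : inner ℝ u (x - y) ≤ breadth Ω u * ‖u‖ := by
  rcases eq_or_ne u 0 with rfl | hu
  · simp
  obtain ⟨ω, -, η, -, h, h1, h2⟩ := exists_breadth_eq ⟨x, hx⟩ hcomp u
  rw [h, div_mul_cancel₀ _ (norm_ne_zero_iff.2 hu), inner_sub_right, inner_sub_right]
  linarith [h1 x hx, h2 y hy]

theorem breadth_nonneg {Ω : Set Plane} (hne : Ω.Nonempty) (hcomp : IsCompact Ω) (u : Plane) :
    0 ≤ breadth Ω u := by
  obtain ⟨ω, hω, η, hη, h, h1, h2⟩ := exists_breadth_eq hne hcomp u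
  rw [h, inner_sub_right]
  exact div_nonneg (sub_nonneg.2 (h1 η hη)) (norm_nonneg _)

open scoped Pointwise in
theorem breadth_smul (Ω : Set Plane) (u : Plane) {c : ℝ} (hc : 0 < c) :
    breadth Ω (c • u) = breadth Ω u := by
  have h : (fun ω => inner ℝ (c • u) ω) '' Ω = c • ((fun ω => inner ℝ u ω) '' Ω) := by
    rw [← image_smul, image_image]
    simp [inner_smul_left]
  rw [breadth, breadth, h, Real.sSup_smul_of_nonneg hc.le, Real.sInf_smul_of_nonneg hc.le,
    norm_smul, Real.norm_of_nonneg hc.le, smul_eq_mul, smul_eq_mul, ← mul_sub,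
    mul_div_mul_left _ _ hc.ne']

/-- Breadth is continuous on the unit circle and invariant under positive scaling, so compactness
suffices. -/
theorem exists_isMinimalDirection {Ω : Set Plane} (hcomp : IsCompact Ω) :
    ∃ u, IsMinimalDirection Ω u := by
  have hcont : ContinuousOn (breadth Ω) (Metric.sphere 0 1) := by
    have hin : Continuous ↿(fun (u ω : Plane) => (inner ℝ u ω : ℝ)) := by
      change Continuous fun p : Plane × Plane => (inner ℝ p.1 p.2 : ℝ)
      fun_prop
    refine ContinuousOn.div ?_ continuous_norm.continuousOn fun u hu => ?_
    · exact ((hcomp.continuous_sSup hin).sub (hcomp.continuous_sInf hin)).continuousOn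
    · rw [mem_sphere_zero_iff_norm.1 hu]; exact one_ne_zero
  obtain ⟨u, hu, hmin⟩ := (isCompact_sphere (0 : Plane) 1).exists_isMinOn
    (NormedSpace.sphere_nonempty.2 zero_le_one) hcont
  refine ⟨u, norm_ne_zero_iff.1 (by rw [mem_sphere_zero_iff_norm.1 hu]; exact one_ne_zero),
    fun u' hu' => ?_⟩
  have h0 : 0 < ‖u'‖⁻¹ := inv_pos.2 (norm_pos_iff.2 hu')
  rw [← breadth_smul Ω u' h0]
  refine hmin ?_
  rw [mem_sphere_zero_iff_norm, norm_smul, norm_inv, norm_norm,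
    inv_mul_cancel₀ (norm_ne_zero_iff.2 hu')]

theorem IsMinimalDirection.width_eq {Ω : Set Plane} {u : Plane} (hu : IsMinimalDirection Ω u) :
    width Ω = breadth Ω u :=
  IsLeast.csInf_eq ⟨⟨u, hu.1, rfl⟩, by rintro - ⟨u', hu', rfl⟩; exact hu.2 u' hu'⟩

theorem width_le_breadth {Ω : Set Plane} (hcomp : IsCompact Ω) {u : Plane} (hu : u ≠ 0) :
    width Ω ≤ breadth Ω u := by
  obtain ⟨u₀, h⟩ := exists_isMinimalDirection hcomp
  rw [h.width_eq]
  exact h.2 u hu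

theorem width_nonneg {Ω : Set Plane} (hne : Ω.Nonempty) (hcomp : IsCompact Ω) : 0 ≤ width Ω := by
  obtain ⟨u₀, h⟩ := exists_isMinimalDirection hcomp
  rw [h.width_eq]
  exact breadth_nonneg hne hcomp u₀

/-- A compact convex set contains a chord parallel and equal to any vector no longer than its
width. -/
theorem exists_chord_of_norm_le_width {Ω : Set Plane} (hne : Ω.Nonempty) (hcomp : IsCompact Ω)
    (hconv : Convex ℝ Ω) {s : Plane} (hs : ‖s‖ ≤ width Ω) : ∃ a ∈ Ω, a + s ∈ Ω := by
  by_contra! hcon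
  -- If `s` is outside the compact convex set `D = Ω - Ω`, some `v` separates it strictly. But `⟪v,
  -- ·⟫` reaches `breadth Ω v * ‖v‖ ≥ width Ω * ‖v‖` on `D`, which is at least `⟪v, s⟫` by
  -- Cauchy–Schwarz.
  set D : Set Plane := (fun p : Plane × Plane => p.1 - p.2) '' (Ω ×ˢ Ω)
  have hD : IsCompact D := (hcomp.prod hcomp).image (by fun_prop)
  have hDc : Convex ℝ D := (hconv.prod hconv).is_linear_image
    (LinearMap.fst ℝ Plane Plane - LinearMap.snd ℝ Plane Plane).isLinear
  have hsD : s ∉ D := by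
    rintro ⟨⟨x, y⟩, ⟨hx, hy⟩, h⟩
    refine hcon y hy ?_
    rwa [← h, add_sub_cancel]
  obtain ⟨f, c, h1, h2⟩ := geometric_hahn_banach_closed_point hDc hD.isClosed hsD
  set v := (InnerProductSpace.toDual ℝ Plane).symm f
  have hf : ∀ x, f x = inner ℝ v x := fun x => by
    rw [InnerProductSpace.toDual_symm_apply]
  obtain ⟨ω, hω, η, hη, h, -, -⟩ := exists_breadth_eq hne hcomp v
  have hv : v ≠ 0 := by
    intro hv0
    have h3 := h1 _ ⟨(ω, η), ⟨hω, hη⟩, rfl⟩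
    rw [hf, hv0, inner_zero_left] at h2 h3
    linarith
  have h3 := h1 _ ⟨(ω, η), ⟨hω, hη⟩, rfl⟩
  have hv' : 0 < ‖v‖ := norm_pos_iff.2 hv
  have h4 := width_le_breadth hcomp hv
  rw [h, le_div_iff₀ hv'] at h4
  rw [hf] at h2 h3
  have h5 := real_inner_le_norm v s
  have h6 : ‖v‖ * ‖s‖ ≤ width Ω * ‖v‖ := by rw [mul_comm]; gcongr
  linarith

/-- All vectors of a small ball are chords, so `Ω` spans the plane affinely. -/
theorem interior_nonempty_of_width_pos {Ω : Set Plane} (hne : Ω.Nonempty) (hcomp : IsCompact Ω)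
    (hconv : Convex ℝ Ω) (hW : 0 < width Ω) : (interior Ω).Nonempty := by
  rw [hconv.interior_nonempty_iff_affineSpan_eq_top,
    AffineSubspace.affineSpan_eq_top_iff_vectorSpan_eq_top_of_nonempty _ _ _ hne]
  refine Submodule.eq_top_of_nonempty_interior' _ ⟨0, ?_⟩
  rw [mem_interior_iff_mem_nhds]
  filter_upwards [Metric.closedBall_mem_nhds (0 : Plane) hW] with s hs
  obtain ⟨a, ha, has⟩ := exists_chord_of_norm_le_width hne hcomp hconv
    (mem_closedBall_zero_iff.1 hs)
  simpa using vsub_mem_vectorSpan ℝ has ha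

/-! ### Geometry of a family of lines -/

/-- Equispaced parallel lines `t ↦ base + j • step + t • dir`, `j ∈ ℤ`, the spacing vector being
orthogonal to the direction. -/
structure LineFamily where
  base : Plane
  step : Plane
  dir : Plane
  step_ne : step ≠ 0
  dir_ne : dir ≠ 0
  inner_eq : inner ℝ step dir = 0

namespace LineFamily

/-- The `j`-th line of the family. -/
def curve (L : LineFamily) (j : ℤ) : ℝ → Plane := fun t => L.base + (j : ℝ) • L.step + t • L.dir

/-- All lines of the family. -/
def curves (L : LineFamily) : Set (ℝ → Plane) := range L.curve

/-- The signed distance from `x` to the `j`-th line. -/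
def offset (L : LineFamily) (x : Plane) (j : ℤ) : ℝ :=
  inner ℝ L.step (L.base - x) / ‖L.step‖ + j * ‖L.step‖

theorem norm_step_pos (L : LineFamily) : 0 < ‖L.step‖ := norm_pos_iff.2 L.step_ne

theorem norm_dir_pos (L : LineFamily) : 0 < ‖L.dir‖ := norm_pos_iff.2 L.dir_ne

theorem curve_injective (L : LineFamily) : Function.Injective L.curve := by
  intro j k h
  have h0 := congrFun h 0
  simp only [curve, zero_smul, add_zero, add_right_inj] at h0
  exact_mod_cast smul_left_injective ℝ L.step_ne h0

theorem exists_orthonormalBasis (L : LineFamily) : ∃ b : OrthonormalBasis (Fin 2) ℝ Plane,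
    b 0 = ‖L.step‖⁻¹ • L.step ∧ b 1 = ‖L.dir‖⁻¹ • L.dir := by
  have hs := L.norm_step_pos
  have hd := L.norm_dir_pos
  have ho : Orthonormal ℝ ![‖L.step‖⁻¹ • L.step, ‖L.dir‖⁻¹ • L.dir] := by
    rw [orthonormal_vecCons_iff]
    refine ⟨?_, ?_, ?_⟩
    · rw [norm_smul, norm_inv, norm_norm, inv_mul_cancel₀ hs.ne']
    · intro i
      fin_cases i
      simp [inner_smul_left, inner_smul_right, L.inner_eq]
    · rw [orthonormal_vecCons_iff]
      refine ⟨?_, fun i => i.elim0, ?_⟩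
      · rw [norm_smul, norm_inv, norm_norm, inv_mul_cancel₀ hd.ne']
      · exact ⟨fun i => i.elim0, fun i => i.elim0⟩
  obtain ⟨b, hb⟩ := Orthonormal.exists_orthonormalBasis_extension_of_card_eq (𝕜 := ℝ)
    (E := Plane) (ι := Fin 2) (by simp) (v := ![‖L.step‖⁻¹ • L.step, ‖L.dir‖⁻¹ • L.dir])
    (s := univ) (ho.comp _ Subtype.val_injective)
  exact ⟨b, hb 0 (mem_univ _), hb 1 (mem_univ _)⟩

theorem eq_add (L : LineFamily) (z : Plane) :
    z = (inner ℝ L.step z / ‖L.step‖) • ‖L.step‖⁻¹ • L.step +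
      (inner ℝ L.dir z / ‖L.dir‖) • ‖L.dir‖⁻¹ • L.dir := by
  obtain ⟨b, h0, h1⟩ := L.exists_orthonormalBasis
  have h := b.sum_repr' z
  rw [Fin.sum_univ_two, h0, h1, inner_smul_left, inner_smul_left] at h
  conv_lhs => rw [← h]
  simp [div_eq_inv_mul]

theorem norm_sq_eq (L : LineFamily) (z : Plane) :
    ‖z‖ ^ 2 = (inner ℝ L.step z / ‖L.step‖) ^ 2 + (inner ℝ L.dir z / ‖L.dir‖) ^ 2 := by
  obtain ⟨b, h0, h1⟩ := L.exists_orthonormalBasis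
  have h := b.sum_sq_inner_right z
  rw [Fin.sum_univ_two, h0, h1, inner_smul_left, inner_smul_left] at h
  rw [← h]
  simp [div_eq_inv_mul]

/-- The signed distance of `curve j t` from the foot of the perpendicular dropped from `x`. -/
def arc (L : LineFamily) (x : Plane) (t : ℝ) : ℝ :=
  inner ℝ L.dir (L.base - x) / ‖L.dir‖ + t * ‖L.dir‖

theorem inner_step_curve (L : LineFamily) (x : Plane) (j : ℤ) (t : ℝ) :
    inner ℝ L.step (L.curve j t - x) / ‖L.step‖ = L.offset x j := by
  have h : L.curve j t - x = (L.base - x) + (j : ℝ) • L.step + t • L.dir := by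
    rw [curve]; abel
  rw [h, inner_add_right, inner_add_right, inner_smul_right, inner_smul_right, L.inner_eq,
    real_inner_self_eq_norm_sq, offset]
  have := L.norm_step_pos
  field_simp
  ring

theorem inner_dir_curve (L : LineFamily) (x : Plane) (j : ℤ) (t : ℝ) :
    inner ℝ L.dir (L.curve j t - x) / ‖L.dir‖ = L.arc x t := by
  have h : L.curve j t - x = (L.base - x) + (j : ℝ) • L.step + t • L.dir := by
    rw [curve]; abel
  rw [h, inner_add_right, inner_add_right, inner_smul_right, inner_smul_right,
    real_inner_comm L.step L.dir, L.inner_eq, real_inner_self_eq_norm_sq, arc]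
  have := L.norm_dir_pos
  field_simp
  ring

theorem mem_timesIn_iff (L : LineFamily) (x : Plane) (j : ℤ) {a : ℝ} (ha : 0 ≤ a) (t : ℝ) :
    t ∈ timesIn (L.curve j) a x ↔ L.offset x j ^ 2 + L.arc x t ^ 2 ≤ a ^ 2 := by
  rw [timesIn, mem_ofPred_eq, ← sq_le_sq₀ (norm_nonneg _) ha, L.norm_sq_eq, inner_step_curve,
    inner_dir_curve]

theorem deriv_curve (L : LineFamily) (j : ℤ) (t : ℝ) : deriv (L.curve j) t = L.dir := by
  have h : HasDerivAt (L.curve j) ((1 : ℝ) • L.dir) t :=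
    ((hasDerivAt_id t).smul_const L.dir).const_add _
  rw [h.deriv, one_smul]

theorem differentiable_curve (L : LineFamily) (j : ℤ) : Differentiable ℝ (L.curve j) := by
  unfold curve; fun_prop

end LineFamily

/-! ### Lengths in discs and path density -/

/-- The length of the chord cut from a line at distance `p` from the centre of a disc of
radius `a`. -/
def chord (a p : ℝ) : ℝ≥0∞ := ENNReal.ofReal (2 * √(a ^ 2 - p ^ 2))

theorem volume_setOf_sq_add_sq_le (a p : ℝ) :
    volume {q : ℝ | p ^ 2 + q ^ 2 ≤ a ^ 2} = chord a p := by
  rcases lt_or_ge (a ^ 2) (p ^ 2) with h | h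
  · have : {q : ℝ | p ^ 2 + q ^ 2 ≤ a ^ 2} = ∅ := by
      ext q; simp only [mem_ofPred_eq, mem_empty_iff_false, iff_false]; nlinarith [sq_nonneg q]
    rw [this, chord, Real.sqrt_eq_zero_of_nonpos (by linarith)]
    simp
  · have : {q : ℝ | p ^ 2 + q ^ 2 ≤ a ^ 2} = Icc (-√(a ^ 2 - p ^ 2)) (√(a ^ 2 - p ^ 2)) := by
      ext q
      rw [mem_ofPred_eq, mem_Icc, ← abs_le, Real.le_sqrt (abs_nonneg _) (by linarith), sq_abs]
      constructor <;> intro <;> linarith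
    rw [this, Real.volume_Icc, chord]
    congr 1; ring

/-- Cavalieri's principle: the disc is sliced into parallel chords. -/
theorem lintegral_chord {a : ℝ} (ha : 0 ≤ a) :
    ∫⁻ p, chord a p = volume (Metric.closedBall (0 : Plane) a) := by
  have hm : MeasurableSet {z : ℝ × ℝ | z.1 ^ 2 + z.2 ^ 2 ≤ a ^ 2} :=
    measurableSet_le (by fun_prop) (by fun_prop)
  have hpres := (volume_preserving_finTwoArrow ℝ).comp (PiLp.volume_preserving_ofLp (Fin 2))
  have hball : Metric.closedBall (0 : Plane) a =
      (MeasurableEquiv.finTwoArrow ∘ WithLp.ofLp) ⁻¹'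
        {z : ℝ × ℝ | z.1 ^ 2 + z.2 ^ 2 ≤ a ^ 2} := by
    ext y
    rw [mem_closedBall_zero_iff, ← sq_le_sq₀ (norm_nonneg _) ha, EuclideanSpace.norm_sq_eq,
      Fin.sum_univ_two]
    simp [MeasurableEquiv.finTwoArrow]
  rw [hball, hpres.measure_preimage hm.nullMeasurableSet, Measure.volume_eq_prod,
    Measure.prod_apply hm]
  exact lintegral_congr fun p => (volume_setOf_sq_add_sq_le a p).symm

/-- Enlarging the radius by `b` outweighs displacing the line by `b`. Chord sums over equispaced
lines, read as Riemann sums, are thus squeezed between areas of discs whose radii differ by the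
spacing. -/
theorem chord_mono {a b p q : ℝ} (ha : 0 ≤ a) (h : |p - q| ≤ b) : chord a p ≤ chord (a + b) q := by
  unfold chord
  have hb : 0 ≤ b := (abs_nonneg _).trans h
  rcases lt_or_ge (a ^ 2) (p ^ 2) with h' | h'
  · rw [Real.sqrt_eq_zero_of_nonpos (by linarith)]; simp
  · gcongr ENNReal.ofReal (2 * √?_)
    have h1 : |p| ≤ a := abs_le_of_sq_le_sq h' ha
    have h2 : |q| ≤ |p| + b := by
      have := abs_sub_abs_le_abs_sub q p
      rw [abs_sub_comm] at this
      linarith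
    rw [← sq_abs p, ← sq_abs q]
    nlinarith [abs_nonneg p, abs_nonneg q]

theorem lintegral_eq_tsum_Ioc {Δ : ℝ} (hΔ : 0 < Δ) (c : ℝ) (g : ℝ → ℝ≥0∞) :
    ∫⁻ p, g p = ∑' j : ℤ, ∫⁻ p in Ioc (c + j • Δ) (c + (j + 1) • Δ), g p := by
  rw [← lintegral_iUnion (fun _ => measurableSet_Ioc) (pairwise_disjoint_Ioc_add_zsmul c Δ),
    iUnion_Ioc_add_zsmul hΔ, Measure.restrict_univ]

theorem volume_closedBall_le_tsum_chord {a Δ : ℝ} (ha : 0 ≤ a) (hΔ : 0 < Δ) (c : ℝ) :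
    volume (Metric.closedBall (0 : Plane) a) ≤
      ENNReal.ofReal Δ * ∑' j : ℤ, chord (a + Δ) (c + j * Δ) := by
  rw [← lintegral_chord ha, lintegral_eq_tsum_Ioc hΔ c, ← ENNReal.tsum_mul_left]
  refine ENNReal.tsum_le_tsum fun j => ?_
  calc _ ≤ ∫⁻ _ in Ioc (c + j • Δ) (c + (j + 1) • Δ), chord (a + Δ) (c + j * Δ) := by
        refine setLIntegral_mono' measurableSet_Ioc fun p hp => chord_mono ha ?_
        simp only [zsmul_eq_mul, Int.cast_add, Int.cast_one, mem_Ioc] at hp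
        rw [abs_le]; constructor <;> linarith [hp.1, hp.2]
    _ = _ := by
        rw [setLIntegral_const, Real.volume_Ioc, mul_comm]
        congr 2; simp; ring

theorem tsum_chord_le_volume_closedBall {a Δ : ℝ} (ha : 0 ≤ a) (hΔ : 0 < Δ) (c : ℝ) :
    ENNReal.ofReal Δ * ∑' j : ℤ, chord a (c + j * Δ) ≤
      volume (Metric.closedBall (0 : Plane) (a + Δ)) := by
  rw [← lintegral_chord (by linarith), lintegral_eq_tsum_Ioc hΔ c, ← ENNReal.tsum_mul_left]
  refine ENNReal.tsum_le_tsum fun j => ?_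
  calc _ = ∫⁻ _ in Ioc (c + j • Δ) (c + (j + 1) • Δ), chord a (c + j * Δ) := by
        rw [setLIntegral_const, Real.volume_Ioc, mul_comm]
        congr 2; simp; ring
    _ ≤ _ := by
        refine setLIntegral_mono' measurableSet_Ioc fun p hp => chord_mono ha ?_
        simp only [zsmul_eq_mul, Int.cast_add, Int.cast_one, mem_Ioc] at hp
        rw [abs_le]; constructor <;> linarith [hp.1, hp.2]

namespace LineFamily

theorem lintegral_timesIn_curve (L : LineFamily) (j : ℤ) {a : ℝ} (ha : 0 ≤ a) (x : Plane) :
    ∫⁻ t in timesIn (L.curve j) a x, ENNReal.ofReal ‖deriv (L.curve j) t‖ =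
      chord a (L.offset x j) := by
  have hd := L.norm_dir_pos
  simp only [deriv_curve, setLIntegral_const]
  have h : timesIn (L.curve j) a x = (fun t => t * ‖L.dir‖) ⁻¹'
      ((fun q => inner ℝ L.dir (L.base - x) / ‖L.dir‖ + q) ⁻¹'
        {q : ℝ | L.offset x j ^ 2 + q ^ 2 ≤ a ^ 2}) := by
    ext t; rw [L.mem_timesIn_iff x j ha]; rfl
  rw [h, Real.volume_preimage_mul_right hd.ne', measure_preimage_add, volume_setOf_sq_add_sq_le,
    abs_of_pos (inv_pos.2 hd), ← mul_assoc, ← ENNReal.ofReal_mul hd.le, mul_inv_cancel₀ hd.ne',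
    ENNReal.ofReal_one, one_mul]

theorem lengthIn_curves (L : LineFamily) {a : ℝ} (ha : 0 ≤ a) (x : Plane) :
    lengthIn L.curves a x = ∑' j : ℤ, chord a (L.offset x j) := by
  rw [lengthIn, curves, tsum_range (fun p : ℝ → Plane => ∫⁻ t in timesIn p a x,
    ENNReal.ofReal ‖deriv p t‖) L.curve_injective]
  simp only [L.lintegral_timesIn_curve _ ha]

theorem volume_closedBall_le_lengthIn (L : LineFamily) {a : ℝ} (ha : 0 ≤ a) (x : Plane) :
    volume (Metric.closedBall (0 : Plane) a) ≤
      ENNReal.ofReal ‖L.step‖ * lengthIn L.curves (a + ‖L.step‖) x := by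
  rw [L.lengthIn_curves (by positivity)]
  exact volume_closedBall_le_tsum_chord ha L.norm_step_pos _

theorem lengthIn_le_volume_closedBall (L : LineFamily) {a : ℝ} (ha : 0 ≤ a) (x : Plane) :
    ENNReal.ofReal ‖L.step‖ * lengthIn L.curves a x ≤
      volume (Metric.closedBall (0 : Plane) (a + ‖L.step‖)) := by
  rw [L.lengthIn_curves ha]
  exact tsum_chord_le_volume_closedBall ha L.norm_step_pos _

theorem pathDensity_curves_le (L : LineFamily) :
    pathDensity L.curves ≤ ENNReal.ofReal ‖L.step‖⁻¹ := by
  have hs := L.norm_step_pos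
  have hlim : Tendsto (fun a : ℝ => (1 + ‖L.step‖ * a⁻¹) ^ 2 * ‖L.step‖⁻¹) atTop
      (𝓝 ‖L.step‖⁻¹) := by
    have := (((tendsto_inv_atTop_zero (𝕜 := ℝ)).const_mul ‖L.step‖).const_add 1).pow 2
    simpa using this.mul_const ‖L.step‖⁻¹
  rw [pathDensity, ← ((ENNReal.continuous_ofReal.tendsto _).comp hlim).limsup_eq]
  refine limsup_le_limsup ?_
  filter_upwards [eventually_gt_atTop 0] with a ha
  have hle : (⨆ x : Plane, lengthIn L.curves a x) ≤
      volume (Metric.closedBall (0 : Plane) (a + ‖L.step‖)) / ENNReal.ofReal ‖L.step‖ := by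
    refine iSup_le fun x => ?_
    rw [ENNReal.le_div_iff_mul_le (Or.inl (by simpa using L.step_ne)) (Or.inl (by simp)), mul_comm]
    exact L.lengthIn_le_volume_closedBall ha.le x
  refine (ENNReal.div_le_div_right hle _).trans (le_of_eq ?_)
  rw [EuclideanSpace.volume_closedBall_fin_two, EuclideanSpace.volume_closedBall_fin_two,
    ← ENNReal.ofReal_pow (by positivity), ← ENNReal.ofReal_pow ha.le,
    ← ENNReal.ofReal_mul (by positivity), ← ENNReal.ofReal_mul (by positivity),
    ← ENNReal.ofReal_div_of_pos hs, ← ENNReal.ofReal_div_of_pos (by positivity),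
    Function.comp_apply]
  congr 1
  have := Real.pi_pos
  field_simp

end LineFamily

/-- If the families `l` cover `Q` with an overlap of length at most `C * a` in discs of radius `a`,
then the densities of the families add up to at most the path density of `Q`. -/
theorem sum_inv_le_pathDensity {Q : Set (ℝ → Plane)} (l : List LineFamily) {C : ℝ}
    (hC0 : 0 ≤ C)
    (hC : ∀ a : ℝ, 0 ≤ a → ∀ x, (l.map fun L => lengthIn L.curves a x).sum ≤
      lengthIn Q a x + ENNReal.ofReal (C * a)) :
    ENNReal.ofReal (l.map fun L => ‖L.step‖⁻¹).sum ≤ pathDensity Q := by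
  -- Each summand is the area of the disc of radius `a - ‖step‖` divided by `‖step‖ * π a²`; the
  -- subtracted term is the overlap `C * a` divided by `π a²`.
  have hlim : Tendsto (fun a : ℝ => (l.map fun L => (1 - ‖L.step‖ * a⁻¹) ^ 2 * ‖L.step‖⁻¹).sum -
      C / Real.pi * a⁻¹) atTop (𝓝 (l.map fun L => ‖L.step‖⁻¹).sum) := by
    have h1 : Tendsto (fun a : ℝ => (l.map fun L => (1 - ‖L.step‖ * a⁻¹) ^ 2 * ‖L.step‖⁻¹).sum)
        atTop (𝓝 (l.map fun L => ‖L.step‖⁻¹).sum) := by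
      refine tendsto_list_sum l fun L _ => ?_
      have := (((tendsto_inv_atTop_zero (𝕜 := ℝ)).const_mul ‖L.step‖).const_sub 1).pow 2
      simpa using this.mul_const ‖L.step‖⁻¹
    simpa using h1.sub ((tendsto_inv_atTop_zero (𝕜 := ℝ)).const_mul (C / Real.pi))
  rw [pathDensity, ← ((ENNReal.continuous_ofReal.tendsto _).comp hlim).limsup_eq]
  refine limsup_le_limsup ?_
  have hlarge : ∀ᶠ a : ℝ in atTop, ∀ L ∈ l, ‖L.step‖ ≤ a := by
    clear hlim hC
    induction l with
    | nil => simp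
    | cons L l ih =>
      filter_upwards [ih, eventually_ge_atTop ‖L.step‖] with a h1 h2
      simpa using ⟨h2, h1⟩
  filter_upwards [eventually_gt_atTop 0, hlarge] with a ha hl
  have hpi := Real.pi_pos
  rw [EuclideanSpace.volume_closedBall_fin_two, ← ENNReal.ofReal_pow ha.le,
    ← ENNReal.ofReal_mul (by positivity),
    ENNReal.le_div_iff_mul_le (Or.inl (by simp; positivity)) (by simp), Function.comp_apply,
    ← ENNReal.ofReal_mul' (by positivity)]
  refine le_trans ?_ (le_iSup (fun x => lengthIn Q a x) 0)
  have hsum : ENNReal.ofReal (l.map fun L => Real.pi * (a - ‖L.step‖) ^ 2 / ‖L.step‖).sum ≤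
      (l.map fun L => lengthIn L.curves a 0).sum := by
    clear hlim hC hlarge
    induction l with
    | nil => simp
    | cons L l ih =>
      simp only [List.map_cons, List.sum_cons]
      have hs := L.norm_step_pos
      refine ENNReal.ofReal_add_le.trans (add_le_add ?_ (ih fun L hL => hl L (by simp [hL])))
      have h := L.volume_closedBall_le_lengthIn (sub_nonneg.2 (hl L (by simp))) 0
      rw [sub_add_cancel, EuclideanSpace.volume_closedBall_fin_two,
        ← ENNReal.ofReal_pow (sub_nonneg.2 (hl L (by simp))),
        ← ENNReal.ofReal_mul (by positivity)] at h
      rw [ENNReal.ofReal_div_of_pos hs]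
      refine ENNReal.div_le_of_le_mul' ?_
      rwa [mul_comm Real.pi]
  have heq : ((l.map fun L => (1 - ‖L.step‖ * a⁻¹) ^ 2 * ‖L.step‖⁻¹).sum - C / Real.pi * a⁻¹) *
      (a ^ 2 * Real.pi) =
      (l.map fun L => Real.pi * (a - ‖L.step‖) ^ 2 / ‖L.step‖).sum - C * a := by
    rw [sub_mul, ← List.sum_map_mul_right]
    congr 1
    · congr 1
      refine List.map_congr_left fun L _ => ?_
      have hs := L.norm_step_pos
      field_simp
    · field_simp
  rw [heq]
  rw [ENNReal.ofReal_sub _ (by positivity)]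
  exact tsub_le_iff_right.2 (hsum.trans (hC a ha.le 0))

/-! ### Cutting a union into almost disjoint families -/

theorem lengthIn_union_of_disjoint {P R : Set (ℝ → Plane)} (h : Disjoint P R) (a : ℝ) (x : Plane) :
    lengthIn (P ∪ R) a x = lengthIn P a x + lengthIn R a x :=
  ENNReal.summable.tsum_union_disjoint (f := fun p : ℝ → Plane =>
    ∫⁻ t in timesIn p a x, ENNReal.ofReal ‖deriv p t‖) h ENNReal.summable

theorem lengthIn_add_le (P R : Set (ℝ → Plane)) (a : ℝ) (x : Plane) :
    lengthIn P a x + lengthIn R a x ≤ lengthIn (P ∪ R) a x + lengthIn (R ∩ P) a x := by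
  have h1 : lengthIn (P ∪ R) a x = lengthIn P a x + lengthIn (R \ P) a x := by
    rw [← union_sdiff_self, lengthIn_union_of_disjoint disjoint_sdiff_right]
  have h2 : lengthIn R a x = lengthIn (R \ P) a x + lengthIn (R ∩ P) a x := by
    rw [← lengthIn_union_of_disjoint disjoint_sdiff_inter, sdiff_union_inter]
  rw [h1, h2, add_assoc]

theorem chord_le {a : ℝ} (ha : 0 ≤ a) (p : ℝ) : chord a p ≤ ENNReal.ofReal (2 * a) := by
  unfold chord
  gcongr
  exact (Real.sqrt_le_sqrt (by nlinarith [sq_nonneg p])).trans (Real.sqrt_sq ha).le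

namespace LineFamily

theorem lengthIn_le_of_finite (L : LineFamily) {S : Set (ℝ → Plane)} (hS : S.Finite)
    (hSL : S ⊆ L.curves) {a : ℝ} (ha : 0 ≤ a) (x : Plane) :
    lengthIn S a x ≤ ENNReal.ofReal (S.ncard * 2 * a) := by
  have : Fintype S := hS.fintype
  rw [lengthIn, tsum_fintype]
  calc _ ≤ ∑ _p : S, ENNReal.ofReal (2 * a) := by
        refine Finset.sum_le_sum fun p _ => ?_
        obtain ⟨j, hj⟩ := hSL p.2
        rw [← hj, L.lintegral_timesIn_curve j ha]
        exact chord_le ha _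
    _ = _ := by
        rw [Finset.sum_const, Finset.card_univ, ← _root_.Nat.card_coe_set_eq,
          Nat.card_eq_fintype_card,
          nsmul_eq_mul, mul_assoc, ENNReal.ofReal_mul (p := (Fintype.card S : ℝ)) (by positivity),
          ENNReal.ofReal_natCast]

/-- Every `M`-th line of the family, starting from the `k`-th. -/
def sub (L : LineFamily) (M : ℕ) (hM : M ≠ 0) (k : ℤ) : LineFamily where
  base := L.base + (k : ℝ) • L.step
  step := (M : ℝ) • L.step
  dir := L.dir
  step_ne := smul_ne_zero (by exact_mod_cast hM) L.step_ne
  dir_ne := L.dir_ne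
  inner_eq := by rw [inner_smul_left, L.inner_eq, mul_zero]

theorem sub_curve (L : LineFamily) (M : ℕ) (hM : M ≠ 0) (k j : ℤ) :
    (L.sub M hM k).curve j = L.curve (k + M * j) := by
  ext1 t
  simp only [curve, sub, smul_smul]
  push_cast
  rw [add_smul, add_assoc L.base, mul_comm (M : ℝ)]

theorem sub_curves_subset (L : LineFamily) (M : ℕ) (hM : M ≠ 0) (k : ℤ) :
    (L.sub M hM k).curves ⊆ L.curves := by
  rintro - ⟨j, rfl⟩
  exact ⟨_, (L.sub_curve M hM k j).symm⟩

theorem curves_eq_iUnion_sub (L : LineFamily) (M : ℕ) (hM : M ≠ 0) :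
    L.curves = ⋃ k < M, (L.sub M hM (k : ℕ)).curves := by
  apply Subset.antisymm
  · rintro - ⟨j, rfl⟩
    have h0 : 0 ≤ j % M := Int.emod_nonneg _ (by exact_mod_cast hM)
    have h1 : j % M < M := Int.emod_lt_of_pos _ (by positivity)
    refine mem_iUnion₂.2 ⟨(j % M).toNat, by omega, j / M, ?_⟩
    rw [sub_curve, Int.toNat_of_nonneg h0, Int.emod_add_mul_ediv]
  · exact iUnion₂_subset fun k _ => L.sub_curves_subset M hM k

theorem disjoint_sub (L : LineFamily) (M : ℕ) (hM : M ≠ 0) {k k' : ℕ} (hk : k < M) (hk' : k' < M)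
    (hne : k ≠ k') : Disjoint (L.sub M hM k).curves (L.sub M hM k').curves := by
  rw [Set.disjoint_left]
  rintro - ⟨j, rfl⟩ ⟨j', h⟩
  rw [sub_curve, sub_curve] at h
  have h' := congrArg (· % (M : ℤ)) (L.curve_injective h)
  simp only [Int.add_mul_emod_self_left] at h'
  rw [Int.emod_eq_of_lt (by positivity) (by exact_mod_cast hk'),
    Int.emod_eq_of_lt (by positivity) (by exact_mod_cast hk)] at h'
  omega

theorem curve_add (L : LineFamily) (i j : ℤ) (t : ℝ) :
    L.curve (i + j) t = L.curve i t + (j : ℝ) • L.step := by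
  simp only [curve]; push_cast; rw [add_smul]; abel

/-- A sufficiently fine splitting of `L` separates the lines belonging to `L'` from the others, up
to finitely many exceptions. -/
theorem exists_sub_subset_or_finite_inter (L L' : LineFamily) :
    ∃ m : ℕ, m ≠ 0 ∧ ∀ M : ℕ, ∀ hM : M ≠ 0, m ∣ M → ∀ k : ℤ,
      (L.sub M hM k).curves ⊆ L'.curves ∨ ((L.sub M hM k).curves ∩ L'.curves).Finite := by
  by_cases hsub : (L.curves ∩ L'.curves).Subsingleton
  · exact ⟨1, one_ne_zero, fun M hM _ k => Or.inr
      (hsub.finite.subset (inter_subset_inter_left _ (L.sub_curves_subset M hM k)))⟩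
  rw [Set.not_subsingleton_iff] at hsub
  obtain ⟨_, ⟨⟨j, rfl⟩, ⟨j', hj⟩⟩, _, ⟨⟨k, rfl⟩, ⟨k', hk⟩⟩, hne⟩ := hsub
  have hjk : j ≠ k := fun h => hne (by rw [h])
  have hstep : ((j - k : ℤ) : ℝ) • L.step = ((j' - k' : ℤ) : ℝ) • L'.step := by
    have h1 := L.curve_add k (j - k) 0
    have h2 := L'.curve_add k' (j' - k') 0
    rw [add_sub_cancel] at h1 h2
    rw [hj, hk, h1] at h2
    exact add_left_cancel h2
  -- By `hstep`, translating by a multiple of `(j - k) • L.step` preserves `L'`. A subfamily whose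
  -- index step `M` is a multiple of `j - k` thus lies in `L'` as soon as one of its curves does.
  refine ⟨(j - k).natAbs, by omega, fun M hM hdvd i => ?_⟩
  have hdvd' : (j - k) ∣ (M : ℤ) := by
    rw [← Int.natAbs_dvd]; exact_mod_cast hdvd
  obtain ⟨c, hc⟩ := hdvd'
  rcases ((L.sub M hM i).curves ∩ L'.curves).eq_empty_or_nonempty with he | ⟨_, ⟨n, rfl⟩, n', hn⟩
  · exact Or.inr (he ▸ finite_empty)
  · left
    rintro - ⟨r, rfl⟩
    refine ⟨n' + c * (r - n) * (j' - k'), ?_⟩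
    ext1 t
    have h1 : i + M * r = (i + M * n) + c * (r - n) * (j - k) := by rw [hc]; ring
    rw [sub_curve] at hn
    rw [sub_curve, h1, curve_add, curve_add, hn]
    congr 1
    rw [Int.cast_mul, Int.cast_mul (_ * _), mul_smul, mul_smul, hstep]

end LineFamily

/-- `Q` is a finite union of line families which overlap negligibly. -/
def IsEssentiallyDisjointUnion (Q : Set (ℝ → Plane)) (l : List LineFamily) : Prop :=
  Q = ⋃ L ∈ l, L.curves ∧ ∃ C : ℝ, 0 ≤ C ∧ ∀ a : ℝ, 0 ≤ a → ∀ x,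
    (l.map fun L => lengthIn L.curves a x).sum ≤ lengthIn Q a x + ENNReal.ofReal (C * a)

/-- Each common curve is counted once too often, and a disc of radius `a` cuts length at most `2a`
from it. -/
theorem IsEssentiallyDisjointUnion.cons {Q : Set (ℝ → Plane)} {l : List LineFamily}
    (h : IsEssentiallyDisjointUnion Q l) {L : LineFamily} (hL : (L.curves ∩ Q).Finite) :
    IsEssentiallyDisjointUnion (Q ∪ L.curves) (L :: l) := by
  obtain ⟨hQ, C, hC0, hC⟩ := h
  refine ⟨by simp [hQ, union_comm], C + (L.curves ∩ Q).ncard * 2, by positivity,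
    fun a ha x => ?_⟩
  simp only [List.map_cons, List.sum_cons]
  calc _ ≤ lengthIn L.curves a x + (lengthIn Q a x + ENNReal.ofReal (C * a)) := by
        gcongr; exact hC a ha x
    _ = lengthIn Q a x + lengthIn L.curves a x + ENNReal.ofReal (C * a) := by ring
    _ ≤ lengthIn (Q ∪ L.curves) a x + lengthIn (L.curves ∩ Q) a x + ENNReal.ofReal (C * a) := by
        gcongr ?_ + _
        exact lengthIn_add_le _ _ _ _
    _ ≤ lengthIn (Q ∪ L.curves) a x + ENNReal.ofReal ((L.curves ∩ Q).ncard * 2 * a) +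
          ENNReal.ofReal (C * a) := by
        gcongr
        exact L.lengthIn_le_of_finite hL inter_subset_left ha x
    _ = _ := by
        rw [add_assoc, ← ENNReal.ofReal_add (by positivity) (by positivity)]
        congr 2; ring

/-- `L` is split so finely that each piece is contained in `Q` or shares only finitely many curves
with it. Pieces of the first kind are dropped. The others are adjoined one by one; being mutually
disjoint, they create no further overlap. -/
theorem IsEssentiallyDisjointUnion.union_curves {Q : Set (ℝ → Plane)} {l : List LineFamily}
    (h : IsEssentiallyDisjointUnion Q l) (L : LineFamily) :
    ∃ l', IsEssentiallyDisjointUnion (Q ∪ L.curves) l' := by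
  have hM : ∃ m : ℕ, m ≠ 0 ∧ ∀ M : ℕ, ∀ hM : M ≠ 0, m ∣ M → ∀ k : ℤ,
      (L.sub M hM k).curves ⊆ Q ∨ ((L.sub M hM k).curves ∩ Q).Finite := by
    rw [h.1]
    clear h
    induction l with
    | nil => exact ⟨1, one_ne_zero, by simp⟩
    | cons L' l ih =>
      obtain ⟨m, hm, h1⟩ := ih
      obtain ⟨m', hm', h2⟩ := L.exists_sub_subset_or_finite_inter L'
      -- The dichotomy persists for all multiples of the modulus, so a product serves all members of
      -- `l` at once.
      refine ⟨m * m', mul_ne_zero hm hm', fun M hM hdvd k => ?_⟩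
      simp only [List.mem_cons, iUnion_iUnion_eq_or_left]
      rcases h1 M hM ((dvd_mul_right _ _).trans hdvd) k with h3 | h3
      · exact Or.inl (h3.trans subset_union_right)
      rcases h2 M hM ((dvd_mul_left _ _).trans hdvd) k with h4 | h4
      · exact Or.inl (h4.trans subset_union_left)
      · right
        rw [inter_union_distrib_left]
        exact h4.union h3
  obtain ⟨M, hM0, hM⟩ := hM
  have key : ∀ n ≤ M, ∃ l',
      IsEssentiallyDisjointUnion (Q ∪ ⋃ k < n, (L.sub M hM0 (k : ℕ)).curves) l' := by
    intro n
    induction n with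
    | zero => intro _; exact ⟨l, by simpa using h⟩
    | succ n ih =>
      intro hn
      obtain ⟨l', hl'⟩ := ih (by omega)
      have hstep : Q ∪ ⋃ k < n + 1, (L.sub M hM0 (k : ℕ)).curves =
          (Q ∪ ⋃ k < n, (L.sub M hM0 (k : ℕ)).curves) ∪ (L.sub M hM0 n).curves := by
        rw [biUnion_lt_succ, union_assoc]
      rw [hstep]
      rcases hM M hM0 dvd_rfl n with h1 | h1
      · exact ⟨l', by rwa [union_eq_left.2 (h1.trans subset_union_left)]⟩
      · refine ⟨_, hl'.cons ?_⟩
        rw [inter_union_distrib_left]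
        refine h1.union ?_
        convert finite_empty
        rw [← disjoint_iff_inter_eq_empty, disjoint_iUnion₂_right]
        exact fun k hk => L.disjoint_sub M hM0 (by omega) (by omega) (by omega)
  obtain ⟨l', hl'⟩ := key M le_rfl
  exact ⟨l', by rwa [L.curves_eq_iUnion_sub M hM0]⟩

theorem exists_isEssentiallyDisjointUnion {N : ℕ} (L : Fin N → LineFamily) :
    ∃ l, IsEssentiallyDisjointUnion (⋃ i, (L i).curves) l := by
  have key : ∀ s : Finset (Fin N), ∃ l, IsEssentiallyDisjointUnion (⋃ i ∈ s, (L i).curves) l := by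
    intro s
    induction s using Finset.induction_on with
    | empty => exact ⟨[], by simp, 0, le_rfl, by simp⟩
    | insert i s _ ih =>
      obtain ⟨l, hl⟩ := ih
      rw [Finset.set_biUnion_insert, union_comm]
      exact hl.union_curves (L i)
  simpa using key Finset.univ

/-! ### Uniform sets as line families -/

theorem parallelLines_eq_curves (w : Plane) {n v : Plane} {Δ : ℝ} (hn : ‖n‖ = 1) (hv : v ≠ 0)
    (hnv : inner ℝ n v = 0) (hΔ : 0 < Δ) :
    ∃ L : LineFamily, L.base = w ∧ L.step = Δ • n ∧ L.dir = v ∧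
      L.curves = parallelLines w n v Δ := by
  refine ⟨⟨w, Δ • n, v, smul_ne_zero hΔ.ne' (norm_ne_zero_iff.1 (by simp [hn])), hv,
    by rw [inner_smul_left, hnv, mul_zero]⟩, rfl, rfl, rfl, ?_⟩
  simp only [LineFamily.curves, parallelLines, mul_smul]
  rfl

theorem LineFamily.isUniformSet_curves (L : LineFamily) : IsUniformSet L.curves := by
  have hs := L.norm_step_pos
  refine ⟨L.base, ‖L.step‖⁻¹ • L.step, L.dir, ‖L.step‖, L.dir_ne, ?_, ?_, hs, ?_⟩
  · rw [norm_smul, norm_inv, norm_norm, inv_mul_cancel₀ hs.ne']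
  · rw [inner_smul_left, L.inner_eq, mul_zero]
  · simp only [LineFamily.curves, parallelLines, smul_smul, mul_assoc, mul_inv_cancel₀ hs.ne',
      mul_one]
    rfl

theorem LineFamily.pathDensity_curves (L : LineFamily) :
    pathDensity L.curves = ENNReal.ofReal ‖L.step‖⁻¹ := by
  refine le_antisymm L.pathDensity_curves_le ?_
  simpa using sum_inv_le_pathDensity (Q := L.curves) [L] le_rfl (by simp)

/-! ### Covering the part in a disc by one short curve -/

/-- `S` lies on a continuous curve of length at most `ℓ` ending at `z`. -/
def CoveredByCurve {E : Type*} [NormedAddCommGroup E] (S : Set E) (z : E) (ℓ : ℝ≥0∞) : Prop :=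
  ∃ (T : ℝ) (γ : ℝ → E), 0 ≤ T ∧ Continuous γ ∧ (∀ t, T ≤ t → γ t = z) ∧ S ⊆ γ '' Icc 0 T ∧
    eVariationOn γ (Icc 0 T) ≤ ℓ

namespace CoveredByCurve

variable {E : Type*} [NormedAddCommGroup E] {S : Set E} {z : E} {ℓ : ℝ≥0∞}

theorem empty (z : E) : CoveredByCurve ∅ z 0 :=
  ⟨0, fun _ => z, le_rfl, continuous_const, fun _ _ => rfl, empty_subset _,
    (eVariationOn.subsingleton _ (by simp)).le⟩

theorem union_segment [NormedSpace ℝ E] (h : CoveredByCurve S z ℓ) (z' : E) :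
    CoveredByCurve (S ∪ segment ℝ z z') z' (ℓ + edist z z') := by
  obtain ⟨T, γ, hT, hc, hz, hS, hv⟩ := h
  -- As `γ` rests at `z` from time `T` on, adding a clamped ramp over `[T, T + 1]` appends the
  -- segment without any gluing of continuous pieces.
  set γ' : ℝ → E := fun t => γ t + (max 0 (min 1 (t - T))) • (z' - z) with hγ'
  have h1 : EqOn γ' γ (Icc 0 T) := fun t ht => by
    have : max 0 (min 1 (t - T)) = 0 :=
      max_eq_left ((min_le_right _ _).trans (sub_nonpos.2 ht.2))
    simp [hγ', this]
  have h2 : EqOn γ' ((fun u : ℝ => z + u • (z' - z)) ∘ fun t => t - T) (Icc T (T + 1)) :=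
    fun t ht => by
      have : max 0 (min 1 (t - T)) = t - T := by
        rw [min_eq_right (by linarith [ht.2]), max_eq_right (by linarith [ht.1])]
      simp only [hγ', this, hz t ht.1, Function.comp_apply]
  refine ⟨T + 1, γ', by linarith, by fun_prop, fun t ht => ?_, union_subset ?_ ?_, ?_⟩
  · have : max 0 (min 1 (t - T)) = 1 := by
      rw [min_eq_left (by linarith), max_eq_right zero_le_one]
    simp only [hγ', this, hz t (by linarith), one_smul, add_sub_cancel]
  · intro p hp
    obtain ⟨t, ht, rfl⟩ := hS hp
    exact ⟨t, ⟨ht.1, by linarith [ht.2]⟩, h1 ht⟩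
  · rw [segment_eq_image']
    rintro - ⟨u, hu, rfl⟩
    refine ⟨T + u, ⟨by linarith [hu.1], by linarith [hu.2]⟩, ?_⟩
    rw [h2 ⟨by linarith [hu.1], by linarith [hu.2]⟩]
    simp
  · have hsplit := eVariationOn.Icc_add_Icc γ' (s := univ) hT (by linarith : T ≤ T + 1)
      (mem_univ _)
    simp only [univ_inter] at hsplit
    rw [← hsplit, eVariationOn.eq_of_eqOn h1, eVariationOn.eq_of_eqOn h2]
    refine add_le_add hv ?_
    have hlip : LipschitzWith ‖z' - z‖₊ (fun u : ℝ => z + u • (z' - z)) := by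
      refine LipschitzWith.of_dist_le_mul fun u w => ?_
      rw [dist_add_left, dist_eq_norm, ← sub_smul, norm_smul, mul_comm, coe_nnnorm, dist_eq_norm]
    have hmono : MonotoneOn (fun t : ℝ => t - T) (Icc T (T + 1)) := fun a _ b _ hab => by
      simpa using hab
    refine (hlip.lipschitzOnWith.comp_eVariationOn_le (mapsTo_univ _ _)).trans ?_
    have hvar := hmono.eVariationOn_eq (left_mem_Icc.2 (by linarith))
      (right_mem_Icc.2 (by linarith))
    simp only [inter_self, sub_self, add_sub_cancel_left, sub_zero, ENNReal.ofReal_one] at hvar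
    calc _ ≤ (‖z' - z‖₊ : ℝ≥0∞) * 1 := by gcongr; exact hvar.le
      _ = edist z z' := by rw [mul_one, edist_comm, edist_eq_enorm_sub]; rfl

/-- A curve visiting the segments `[p i, q i]` one after the other. -/
theorem iUnion_segment [NormedSpace ℝ E] (p q : ℕ → E) (m : ℕ) :
    CoveredByCurve (⋃ i < m, segment ℝ (p i) (q i)) (p m)
      (∑ i ∈ Finset.range m, (edist (p i) (q i) + edist (q i) (p (i + 1)))) := by
  induction m with
  | zero => simpa using empty (p 0)
  | succ m ih =>
    have h := (ih.union_segment (q m)).union_segment (p (m + 1))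
    rw [add_assoc, ← Finset.sum_range_succ
      (fun i => edist (p i) (q i) + edist (q i) (p (i + 1)))] at h
    obtain ⟨T, γ, hT, hc, hz, hS, hv⟩ := h
    refine ⟨T, γ, hT, hc, hz, ?_, hv⟩
    rw [biUnion_lt_succ]
    exact subset_union_left.trans hS

theorem exists_curve_on_unitInterval (h : CoveredByCurve S z ℓ) :
    ∃ γ : ℝ → E, ContinuousOn γ (Icc 0 1) ∧ S ⊆ γ '' Icc 0 1 ∧ eVariationOn γ (Icc 0 1) ≤ ℓ := by
  obtain ⟨T, γ, hT, hc, hz, hS, hv⟩ := h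
  refine ⟨γ ∘ fun u => T * u, (hc.comp (by fun_prop)).continuousOn, ?_, ?_⟩
  · intro p hp
    obtain ⟨t, ht, rfl⟩ := hS hp
    rcases hT.eq_or_lt with rfl | hT
    · have : t = 0 := le_antisymm ht.2 ht.1
      exact ⟨0, by simp, by simp [this]⟩
    · exact ⟨t / T, ⟨div_nonneg ht.1 hT.le, (div_le_one hT).2 ht.2⟩, by
        simp [mul_div_cancel₀ _ hT.ne']⟩
  · refine (eVariationOn.comp_le_of_monotoneOn γ (s := Icc 0 T) _
      (fun a _ b _ hab => mul_le_mul_of_nonneg_left hab hT) fun u hu => ?_).trans hv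
    exact ⟨mul_nonneg hT hu.1, mul_le_of_le_one_right hT hu.2⟩

end CoveredByCurve

/-- Subadditivity of the square root. It controls the change in half-length between neighbouring
chords even at the rim of the disc; negative arguments, where `√` is `0`, are allowed. -/
theorem abs_sqrt_sub_sqrt_le (A B : ℝ) : |√A - √B| ≤ √|A - B| := by
  wlog h : B ≤ A generalizing A B
  · rw [abs_sub_comm, abs_sub_comm A]
    exact this B A (le_of_not_ge h)
  have h1 : √A ≤ √(A - B) + √B := by
    rcases le_total B 0 with hB | hB
    · rw [Real.sqrt_eq_zero_of_nonpos hB, add_zero]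
      exact Real.sqrt_le_sqrt (by linarith)
    · rw [Real.sqrt_le_left (by positivity)]
      nlinarith [Real.sq_sqrt hB, Real.sq_sqrt (sub_nonneg.2 h), Real.sqrt_nonneg B,
        Real.sqrt_nonneg (A - B)]
  rw [abs_of_nonneg (sub_nonneg.2 (Real.sqrt_le_sqrt h)), abs_of_nonneg (sub_nonneg.2 h)]
  linarith

theorem add_smul_mem_segment {E : Type*} [AddCommGroup E] [Module ℝ E] (x e : E) {τ h : ℝ}
    (hτ : |τ| ≤ h) : x + τ • e ∈ segment ℝ (x - h • e) (x + h • e) := by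
  have hm : τ ∈ segment ℝ (-h) h := by
    rw [segment_eq_Icc (by linarith [abs_nonneg τ])]
    exact abs_le.1 hτ
  obtain ⟨α, β, hα, hβ, hsum, rfl⟩ := hm
  refine ⟨α, β, hα, hβ, hsum, ?_⟩
  obtain rfl : β = 1 - α := by linarith
  simp only [smul_eq_mul]
  module

/-- Bound for the total length of the connections between consecutive chords of a disc of radius
`a`, cut by lines with spacing `Δ`. -/
def connectorLength (Δ a : ℝ) : ℝ := (2 * a / Δ + 1) * (Δ + √(Δ * (2 * a + 4 * Δ)))

/-- The growth is of order `a^(3/2)`: the quotient by `a²` is a continuous function of `u = 1/a`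
that vanishes at `u = 0`. -/
theorem connectorLength_isLittleO {Δ : ℝ} (hΔ : 0 < Δ) :
    connectorLength Δ =o[atTop] (fun a : ℝ => a ^ 2) := by
  have hφ : Continuous fun u : ℝ => (2 / Δ + u) * (Δ * u + √(Δ * (2 * u + 4 * Δ * u ^ 2))) := by
    fun_prop
  have h0 := (hφ.tendsto 0).comp (tendsto_inv_atTop_zero (𝕜 := ℝ))
  rw [Asymptotics.isLittleO_iff_tendsto' (by
    filter_upwards [eventually_gt_atTop 0] with a ha h
    exact absurd h (by positivity))]
  have h1 : (2 / Δ + 0) * (Δ * 0 + √(Δ * (2 * 0 + 4 * Δ * 0 ^ 2))) = 0 := by simp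
  rw [h1] at h0
  refine h0.congr' ?_
  filter_upwards [eventually_gt_atTop 0] with a ha
  have h2 : Δ * (2 * a⁻¹ + 4 * Δ * a⁻¹ ^ 2) = Δ * (2 * a + 4 * Δ) / a ^ 2 := by field_simp
  rw [Function.comp_apply, connectorLength, h2, Real.sqrt_div' _ (by positivity),
    Real.sqrt_sq ha.le]
  field_simp

namespace LineFamily

theorem portionIn_subset (L : LineFamily) (x : Plane) {a : ℝ} (ha : 0 ≤ a) {z : Plane}
    (hz : z ∈ portionIn L.curves a x) : ∃ j : ℤ, |L.offset x j| ≤ a ∧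
      ∃ τ : ℝ, |τ| ≤ √(a ^ 2 - L.offset x j ^ 2) ∧
        z = x + L.offset x j • ‖L.step‖⁻¹ • L.step + τ • ‖L.dir‖⁻¹ • L.dir := by
  simp only [portionIn, curves, mem_iUnion] at hz
  obtain ⟨_, ⟨j, rfl⟩, t, ht, rfl⟩ := hz
  rw [L.mem_timesIn_iff x j ha] at ht
  refine ⟨j, abs_le_of_sq_le_sq (by nlinarith [sq_nonneg (L.arc x t)]) ha, L.arc x t,
    Real.abs_le_sqrt (by linarith), ?_⟩
  have h := L.eq_add (L.curve j t - x)
  rw [inner_step_curve, inner_dir_curve] at h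
  rw [add_assoc, ← h, add_sub_cancel]

/-- The chords are traversed alternately in opposite directions, so that consecutive endpoints lie
on the same side and are joined by a connector of length at most `Δ + √(Δ (2a + 4Δ))`. -/
theorem nonDegenerate_curves (L : LineFamily) : NonDegenerate L.curves := by
  intro x
  have hΔ := L.norm_step_pos
  set Δ := ‖L.step‖
  refine ⟨connectorLength Δ, connectorLength_isLittleO hΔ, ?_⟩
  filter_upwards [eventually_ge_atTop 0] with a ha
  set n := Δ⁻¹ • L.step with hn
  set e := ‖L.dir‖⁻¹ • L.dir with he
  have hn1 : ‖n‖ = 1 := by rw [hn, norm_smul, norm_inv, Real.norm_of_nonneg hΔ.le,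
    inv_mul_cancel₀ hΔ.ne']
  have he1 : ‖e‖ = 1 := by rw [he, norm_smul, norm_inv, norm_norm,
    inv_mul_cancel₀ L.norm_dir_pos.ne']
  set c : ℝ := inner ℝ L.step (L.base - x) / Δ
  -- `j₀` is the first line with offset at least `-a`, and the lines meeting the disc are among `j₀,
  -- …, j₀ + K`. The last ones may miss it; their half-length `η` is then `0`, and they degenerate
  -- to points.
  set j₀ : ℤ := ⌈(-a - c) / Δ⌉ with hj₀
  set K : ℕ := ⌊2 * a / Δ⌋₊ with hK
  set δ : ℕ → ℝ := fun i => L.offset x (j₀ + i) with hδ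
  have hδeq : ∀ i : ℕ, δ i = c + (j₀ + i) * Δ := fun i => by
    simp only [hδ, offset]; push_cast; rfl
  set η : ℕ → ℝ := fun i => √(a ^ 2 - δ i ^ 2) with hη
  set p : ℕ → Plane := fun i => x + δ i • n - ((-1) ^ i * η i) • e with hp
  set q : ℕ → Plane := fun i => x + δ i • n + ((-1) ^ i * η i) • e with hq
  have hj₀l : -a ≤ c + j₀ * Δ := by
    have := Int.le_ceil ((-a - c) / Δ)
    rw [div_le_iff₀ hΔ] at this
    linarith
  have hj₀u : c + j₀ * Δ ≤ -a + Δ := by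
    have := (Int.ceil_lt_add_one ((-a - c) / Δ)).le
    rw [← sub_le_iff_le_add, le_div_iff₀ hΔ] at this
    linarith
  have hKa : (K : ℝ) * Δ ≤ 2 * a := by
    have := Nat.floor_le (show 0 ≤ 2 * a / Δ by positivity)
    rwa [le_div_iff₀ hΔ] at this
  have hcover : portionIn L.curves a x ⊆ ⋃ i < K + 1, segment ℝ (p i) (q i) := by
    intro z hz
    obtain ⟨j, hj, τ, hτ, rfl⟩ := L.portionIn_subset x ha hz
    have hj' : L.offset x j = c + j * Δ := rfl
    rw [hj', abs_le] at hj
    have h1 : j₀ ≤ j := Int.ceil_le.2 (by rw [div_le_iff₀ hΔ]; linarith [hj.1])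
    obtain ⟨i, rfl⟩ : ∃ i : ℕ, j = j₀ + i := ⟨(j - j₀).toNat, by omega⟩
    have h2 : i ≤ K := Nat.le_floor (by
      rw [le_div_iff₀ hΔ]
      push_cast at hj
      linarith [hj.2])
    refine mem_iUnion₂.2 ⟨i, by omega, ?_⟩
    have hs := add_smul_mem_segment (x + δ i • n) e hτ
    rcases neg_one_pow_eq_or ℝ i with h3 | h3
    · simpa only [hp, hq, h3, one_mul] using hs
    · rw [segment_symm] at hs
      simpa only [hp, hq, h3, neg_one_mul, neg_smul, sub_neg_eq_add, ← sub_eq_add_neg] using hs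
  obtain ⟨γ, h1, h2, h3⟩ :=
    (CoveredByCurve.iUnion_segment p q (K + 1)).exists_curve_on_unitInterval
  refine ⟨γ, h1, hcover.trans h2, h3.trans ?_⟩
  rw [Finset.sum_add_distrib]
  refine add_le_add ?_ ?_
  · have hpq : ∀ i, edist (p i) (q i) = chord a (δ i) := by
      intro i
      have : p i - q i = -((2 * ((-1) ^ i * η i)) • e) := by
        simp only [hp, hq]; module
      rw [edist_dist, dist_eq_norm, this, norm_neg, norm_smul, he1, mul_one, norm_mul, norm_mul,
        norm_pow, norm_neg, norm_one, one_pow, one_mul, Real.norm_of_nonneg (Real.sqrt_nonneg _),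
        Real.norm_of_nonneg zero_le_two, chord]
    rw [L.lengthIn_curves ha]
    simp only [hpq]
    refine (ENNReal.sum_le_tsum _).trans ?_
    exact ENNReal.tsum_comp_le_tsum_of_injective
      (f := fun i : ℕ => j₀ + (i : ℤ)) (fun i k h => by simpa using h)
      (fun j => chord a (L.offset x j))
  · have hqp : ∀ i ∈ Finset.range (K + 1),
        edist (q i) (p (i + 1)) ≤ ENNReal.ofReal (Δ + √(Δ * (2 * a + 4 * Δ))) := by
      intro i hi
      have hiK : (i : ℝ) ≤ K := by exact_mod_cast Nat.lt_succ_iff.1 (Finset.mem_range.1 hi)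
      have hiΔ : (i : ℝ) * Δ ≤ 2 * a := (mul_le_mul_of_nonneg_right hiK hΔ.le).trans hKa
      have hi0 : 0 ≤ (i : ℝ) * Δ := by positivity
      have hsucc : δ (i + 1) = δ i + Δ := by rw [hδeq, hδeq]; push_cast; ring
      have hlo : -a ≤ δ i := by rw [hδeq]; linarith
      have hhi : δ i ≤ a + Δ := by rw [hδeq]; linarith
      have hdiff : q i - p (i + 1) = (-Δ) • n + ((-1) ^ i * (η i - η (i + 1))) • e := by
        simp only [hp, hq, hsucc, pow_succ]; module
      have hηη : |η i - η (i + 1)| ≤ √(Δ * (2 * a + 4 * Δ)) := by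
        refine (abs_sqrt_sub_sqrt_le _ _).trans (Real.sqrt_le_sqrt ?_)
        rw [hsucc, show a ^ 2 - δ i ^ 2 - (a ^ 2 - (δ i + Δ) ^ 2) = Δ * (2 * δ i + Δ) by ring,
          abs_mul, abs_of_pos hΔ]
        gcongr
        rw [abs_le]; constructor <;> linarith
      rw [edist_dist, dist_eq_norm, hdiff]
      refine ENNReal.ofReal_le_ofReal ((norm_add_le _ _).trans ?_)
      rw [norm_smul (-Δ) n, norm_smul _ e, hn1, he1, mul_one, mul_one, norm_neg,
        Real.norm_of_nonneg hΔ.le, norm_mul, norm_pow, norm_neg, norm_one, one_pow, one_mul, Real.norm_eq_abs]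
      linarith
    refine (Finset.sum_le_sum hqp).trans ?_
    rw [Finset.sum_const, Finset.card_range, nsmul_eq_mul, ← ENNReal.ofReal_natCast,
      ← ENNReal.ofReal_mul (by positivity), connectorLength]
    refine ENNReal.ofReal_le_ofReal ?_
    gcongr
    push_cast
    rw [add_le_add_iff_right, le_div_iff₀ hΔ]
    exact hKa

end LineFamily

/-! ### Equispaced lines satisfying the Nyquist condition -/

theorem fourierChar_injOn {s t : ℝ} (hst : |s - t| < 1)
    (h : Real.fourierChar s = Real.fourierChar t) : s = t := by
  have h1 : Complex.exp ((2 * Real.pi * s : ℝ) * Complex.I) =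
      Complex.exp ((2 * Real.pi * t : ℝ) * Complex.I) := by
    rw [← Real.fourierChar_apply, ← Real.fourierChar_apply, h]
  obtain ⟨n, hn⟩ := Complex.exp_eq_exp_iff_exists_int.1 h1
  have h2 : ((2 * Real.pi * s : ℝ) : ℂ) * Complex.I =
      ((2 * Real.pi * (t + n) : ℝ) : ℂ) * Complex.I := by
    rw [hn]; push_cast; ring
  have h3 : 2 * Real.pi * s = 2 * Real.pi * (t + n) := by
    exact_mod_cast mul_right_cancel₀ Complex.I_ne_zero h2
  have h4 : s = t + n := mul_left_cancel₀ (by positivity) h3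
  rw [h4, add_sub_cancel_left] at hst
  have h5 : n = 0 := Int.abs_lt_one_iff.1 (by exact_mod_cast hst)
  simpa [h5] using h4

theorem fourierChar_intCast (n : ℤ) : (Real.fourierChar (n : ℝ) : ℂ) = 1 := by
  rw [Real.fourierChar_apply, Complex.exp_eq_one_iff]
  exact ⟨n, by push_cast; ring⟩

/-- If `y` is short compared to the breadth of `Ω` in its direction, the character of `y`
distinguishes frequencies of `Ω` with different components along `y`. -/
theorem inner_sub_eq_zero_of_fourierChar_eq {Ω : Set Plane} (hcomp : IsCompact Ω) {y : Plane}
    (hy : breadth Ω y * ‖y‖ < 2 * Real.pi) {ω η : Plane} (hω : ω ∈ Ω) (hη : η ∈ Ω)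
    (h : Real.fourierChar (inner ℝ ((2 * Real.pi)⁻¹ • ω) y) =
      Real.fourierChar (inner ℝ ((2 * Real.pi)⁻¹ • η) y)) : inner ℝ y (ω - η) = 0 := by
  have hpi : 0 < 2 * Real.pi := by positivity
  have h1 := inner_sub_le_breadth hcomp y hω hη
  have h2 := inner_sub_le_breadth hcomp y hη hω
  rw [← neg_sub, inner_neg_right] at h2
  have heq : inner ℝ ((2 * Real.pi)⁻¹ • ω) y - inner ℝ ((2 * Real.pi)⁻¹ • η) y =
      (2 * Real.pi)⁻¹ * inner ℝ y (ω - η) := by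
    rw [← inner_sub_left, ← smul_sub, inner_smul_left, real_inner_comm]; rfl
  have h3 := fourierChar_injOn (by
    rw [heq, abs_mul, abs_of_pos (inv_pos.2 hpi), ← div_eq_inv_mul, div_lt_one hpi, abs_lt]
    constructor <;> linarith) h
  rw [h3, sub_self] at heq
  exact (mul_eq_zero.1 heq.symm).resolve_left (inv_ne_zero hpi.ne')

namespace LineFamily

/-- The rectangular lattice with sides `step` and `τ • dir`. -/
def lattice (L : LineFamily) (τ : ℝ) : AddSubgroup Plane :=
  AddSubgroup.closure {L.step, τ • L.dir}

theorem lattice_subset_iUnion_range (L : LineFamily) (hL : L.base = 0) (τ : ℝ) :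
    (L.lattice τ : Set Plane) ⊆ ⋃ p ∈ L.curves, range p := by
  intro z hz
  obtain ⟨m, n, rfl⟩ := AddSubgroup.mem_closure_pair.1 hz
  refine mem_iUnion₂.2 ⟨L.curve m, ⟨m, rfl⟩, n * τ, ?_⟩
  rw [curve, hL, zero_add, ← Int.cast_smul_eq_zsmul ℝ, ← Int.cast_smul_eq_zsmul ℝ, smul_smul]

theorem uniformlyDiscrete_lattice (L : LineFamily) {τ : ℝ} (hτ : 0 < τ) :
    UniformlyDiscrete (L.lattice τ : Set Plane) := by
  have hs := L.norm_step_pos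
  have hd := L.norm_dir_pos
  have hτd : 0 < τ * ‖L.dir‖ := by positivity
  -- Half the shorter side of the lattice, since the separation must be strict.
  refine ⟨min ‖L.step‖ (τ * ‖L.dir‖) / 2, by positivity, fun y hy z hz hne => ?_⟩
  obtain ⟨m, n, h⟩ := AddSubgroup.mem_closure_pair.1 ((L.lattice τ).sub_mem hy hz)
  rw [← Int.cast_smul_eq_zsmul ℝ, ← Int.cast_smul_eq_zsmul ℝ, smul_smul] at h
  have hnorm := L.norm_sq_eq (y - z)
  rw [← h, inner_add_right, inner_add_right, inner_smul_right, inner_smul_right, inner_smul_right,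
    inner_smul_right, L.inner_eq, real_inner_comm L.step L.dir, L.inner_eq,
    real_inner_self_eq_norm_sq, real_inner_self_eq_norm_sq] at hnorm
  have hnorm' : ‖y - z‖ ^ 2 = (m * ‖L.step‖) ^ 2 + (n * (τ * ‖L.dir‖)) ^ 2 := by
    rw [← h, hnorm]
    congr 1 <;> · field_simp; ring
  have hint : ∀ k : ℤ, k ≠ 0 → (1 : ℝ) ≤ (k : ℝ) ^ 2 := fun k hk => by
    rw [← sq_abs]
    exact one_le_pow₀ (by exact_mod_cast Int.one_le_abs hk)
  have hmn : m ≠ 0 ∨ n ≠ 0 := by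
    by_contra! h0
    refine hne (sub_eq_zero.1 ?_)
    rw [← h, h0.1, h0.2]
    simp
  have hmin : min ‖L.step‖ (τ * ‖L.dir‖) ≤ ‖y - z‖ := by
    rcases hmn with h0 | h0
    · refine (min_le_left _ _).trans (abs_le_of_sq_le_sq' ?_ (norm_nonneg _)).2
      rw [hnorm', mul_pow]
      nlinarith [hint _ h0, sq_nonneg (n * (τ * ‖L.dir‖)), sq_nonneg ‖L.step‖]
    · refine (min_le_right _ _).trans (abs_le_of_sq_le_sq' ?_ (norm_nonneg _)).2
      rw [hnorm', mul_pow (n : ℝ)]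
      nlinarith [hint _ h0, sq_nonneg (m * ‖L.step‖), sq_nonneg (τ * ‖L.dir‖)]
  have : 0 < min ‖L.step‖ (τ * ‖L.dir‖) := lt_min hs hτd
  linarith

/-- Equispaced lines through the origin form a Nyquist trajectory set as soon as their spacing is
less than `2π` divided by the breadth of the band across the lines. -/
theorem curves_mem_nyquistUniformUnions (L : LineFamily) (hL : L.base = 0) {Ω : Set Plane}
    (hne : Ω.Nonempty) (hcomp : IsCompact Ω) (hspace : breadth Ω L.step * ‖L.step‖ < 2 * Real.pi) :
    L.curves ∈ NyquistUniformUnions Ω := by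
  have hpi := Real.pi_pos
  have hd := L.norm_dir_pos
  refine ⟨⟨⟨countable_range _, ?_⟩, ?_, L.nonDegenerate_curves⟩, 1, fun _ => L.curves, one_pos,
    fun _ => L.isUniformSet_curves, (iUnion_const _).symm⟩
  · rintro - ⟨j, rfl⟩
    exact L.differentiable_curve j
  have hb := breadth_nonneg hne hcomp L.dir
  -- A sampling step along the lines fine enough for the breadth in their direction; the `+ 1`
  -- covers breadth `0`.
  set τ := Real.pi / (‖L.dir‖ * (breadth Ω L.dir + 1)) with hτdef
  have hτ : 0 < τ := by positivity
  have hτspace : breadth Ω (τ • L.dir) * ‖τ • L.dir‖ < 2 * Real.pi := by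
    rw [breadth_smul _ _ hτ, norm_smul, Real.norm_of_nonneg hτ.le, hτdef]
    have : breadth Ω L.dir * (Real.pi / (‖L.dir‖ * (breadth Ω L.dir + 1)) * ‖L.dir‖) =
        Real.pi * (breadth Ω L.dir / (breadth Ω L.dir + 1)) := by field_simp
    rw [this]
    have h1 : breadth Ω L.dir / (breadth Ω L.dir + 1) ≤ 1 := by
      rw [div_le_one (by positivity)]; linarith
    nlinarith
  refine ⟨L.lattice τ, L.lattice_subset_iUnion_range hL τ, L.uniformlyDiscrete_lattice hτ,
    determines_of_separates hcomp _ fun ω hω η hη hωη => ?_⟩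
  -- Two frequencies that neither lattice generator distinguishes have the same components along
  -- both orthogonal directions.
  by_contra! hcon
  have h1 := inner_sub_eq_zero_of_fourierChar_eq hcomp hspace hω hη
    (hcon _ (AddSubgroup.subset_closure (by simp)))
  have h2 := inner_sub_eq_zero_of_fourierChar_eq hcomp hτspace hω hη
    (hcon _ (AddSubgroup.subset_closure (by simp)))
  rw [inner_smul_left] at h2
  have h3 : inner ℝ L.dir (ω - η) = 0 := (mul_eq_zero.1 h2).resolve_left hτ.ne'
  have h4 := L.eq_add (ω - η)
  rw [h1, h3] at h4
  exact hωη (sub_eq_zero.1 (by simpa using h4))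

end LineFamily

/-! ### The lower bound and the infimum -/

/-- A Nyquist trajectory set made of finitely many uniform sets has path density at least
`width Ω / 2π`. -/
theorem width_div_le_pathDensity {Ω : Set Plane} (hne : Ω.Nonempty) (hcomp : IsCompact Ω)
    (hconv : Convex ℝ Ω) {Q : Set (ℝ → Plane)} (hQ : Q ∈ NyquistUniformUnions Ω) :
    ENNReal.ofReal (width Ω / (2 * Real.pi)) ≤ pathDensity Q := by
  have hpi : 0 < 2 * Real.pi := by positivity
  obtain ⟨⟨-, ⟨Λ, hΛ, -, hdet⟩, -⟩, N, P, -, hP, rfl⟩ := hQ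
  have hL : ∀ i, ∃ L : LineFamily, L.curves = P i := fun i => by
    obtain ⟨w, n, v, Δ, hv, hn, hnv, hΔ, h⟩ := hP i
    obtain ⟨L, -, -, -, hL⟩ := parallelLines_eq_curves w hn hv hnv hΔ
    exact ⟨L, hL.trans h.symm⟩
  choose L hL using hL
  simp only [← hL] at hΛ ⊢
  obtain ⟨l, hl, C, hC0, hC⟩ := exists_isEssentiallyDisjointUnion L
  by_contra! hlt
  have hsum := (ENNReal.ofReal_lt_ofReal_iff_of_nonneg (List.sum_nonneg fun y hy => by
      obtain ⟨M, -, rfl⟩ := List.mem_map.1 hy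
      positivity)).1 ((sum_inv_le_pathDensity l hC0 hC).trans_lt hlt)
  have hsum0 : 0 ≤ (l.map fun M => ‖M.step‖⁻¹).sum := List.sum_nonneg fun y hy => by
    obtain ⟨M, -, rfl⟩ := List.mem_map.1 hy
    positivity
  rw [lt_div_iff₀ hpi] at hsum
  have hW : 0 < width Ω := lt_of_le_of_lt (by positivity) hsum
  obtain ⟨f, hf, hf0, hv⟩ := exists_bandlimited_vanishing hconv
    (interior_nonempty_of_width_pos hne hcomp hconv hW) hW
    (fun s hs => exists_chord_of_norm_le_width hne hcomp hconv hs)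
    -- This vector has length `2π / ‖M.step‖`; its phase measured from `M.base` is constant along
    -- each line and grows by `2π` from one line to the next.
    (l.map fun M => ((2 * Real.pi) • (‖M.step‖ ^ 2)⁻¹ • M.step, M.base))
    (by
      intro p hp
      obtain ⟨M, -, rfl⟩ := List.mem_map.1 hp
      have := M.norm_step_pos
      exact smul_ne_zero hpi.ne' (smul_ne_zero (by positivity) M.step_ne))
    (by
      rw [List.map_map]
      refine lt_of_eq_of_lt ?_ hsum
      rw [← List.sum_map_mul_right]
      congr 1
      refine List.map_congr_left fun M _ => ?_
      have := M.norm_step_pos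
      rw [Function.comp_apply, norm_smul, norm_smul, Real.norm_of_nonneg hpi.le, norm_inv,
        norm_pow, norm_norm]
      field_simp)
  refine hf0 (hdet f hf 0 (Bandlimited.zero_mem Ω) fun x hx => ?_)
  obtain ⟨p, hp, t, rfl⟩ := mem_iUnion₂.1 (hΛ hx)
  rw [hl] at hp
  obtain ⟨M, hM, j, rfl⟩ := mem_iUnion₂.1 hp
  refine hv _ (List.mem_map.2 ⟨M, hM, rfl⟩) _ ?_
  have hM0 := M.norm_step_pos
  have hphase : inner ℝ ((2 * Real.pi)⁻¹ • (2 * Real.pi) • (‖M.step‖ ^ 2)⁻¹ • M.step)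
      (M.curve j t - M.base) = (j : ℝ) := by
    rw [smul_smul, inv_mul_cancel₀ hpi.ne', one_smul, LineFamily.curve, add_assoc,
      add_sub_cancel_left, inner_smul_left, inner_add_right, inner_smul_right, inner_smul_right,
      M.inner_eq, real_inner_self_eq_norm_sq]
    simp only [conj_trivial]
    field_simp
    ring
  rw [hphase, fourierChar_intCast]

theorem exists_ne_zero_inner_eq_zero {u : Plane} (hu : u ≠ 0) :
    ∃ v : Plane, v ≠ 0 ∧ inner ℝ u v = 0 := by
  refine ⟨!₂[-u 1, u 0], fun h => hu ?_, ?_⟩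
  · have h0 := congrFun (congrArg WithLp.ofLp h) 0
    have h1 := congrFun (congrArg WithLp.ofLp h) 1
    ext i
    fin_cases i
    · simpa using h1
    · simpa using h0
  · simp [PiLp.inner_apply, Fin.sum_univ_two]
    ring

/-- Lines perpendicular to a narrowest direction `u` of `Ω`, with any spacing `Δ < 2π / width Ω`,
form a Nyquist trajectory set of path density `Δ⁻¹`. -/
theorem parallelLines_mem_nyquistUniformUnions {Ω : Set Plane} (hne : Ω.Nonempty)
    (hcomp : IsCompact Ω) {u v : Plane} (hu : IsMinimalDirection Ω u) (hv : v ≠ 0)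
    (huv : inner ℝ u v = 0) {Δ : ℝ} (hΔ : 0 < Δ) (hΔW : width Ω * Δ < 2 * Real.pi) :
    parallelLines 0 (‖u‖⁻¹ • u) v Δ ∈ NyquistUniformUnions Ω ∧
      pathDensity (parallelLines 0 (‖u‖⁻¹ • u) v Δ) = ENNReal.ofReal Δ⁻¹ := by
  have hu0 : 0 < ‖u‖⁻¹ := inv_pos.2 (norm_pos_iff.2 hu.1)
  have hn : ‖‖u‖⁻¹ • u‖ = 1 := by
    rw [norm_smul, norm_inv, norm_norm, inv_mul_cancel₀ (norm_ne_zero_iff.2 hu.1)]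
  obtain ⟨L, hbase, hstep, -, hL⟩ := parallelLines_eq_curves 0 hn hv
    (by rw [inner_smul_left, huv, mul_zero]) hΔ
  have hnorm : ‖L.step‖ = Δ := by rw [hstep, norm_smul, hn, mul_one, Real.norm_of_nonneg hΔ.le]
  rw [← hL]
  refine ⟨L.curves_mem_nyquistUniformUnions hbase hne hcomp ?_, ?_⟩
  · rwa [hnorm, hstep, breadth_smul _ _ hΔ, breadth_smul _ _ hu0, ← hu.width_eq]
  · rw [L.pathDensity_curves, hnorm]

end

/-- The least path density of a Nyquist trajectory set that is a finite union of uniform sets is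
the width of the band divided by `2π`, approached by lines perpendicular to a narrowest
direction. -/
theorem theorem2 (Ω : Set Plane) (hne : Ω.Nonempty) (hcomp : IsCompact Ω) (hconv : Convex ℝ Ω) :
    (∃ u : Plane, IsMinimalDirection Ω u) ∧
    (0 < width Ω → ∀ u v : Plane, IsMinimalDirection Ω u → v ≠ 0 → inner ℝ u v = 0 →
      (∀ ε : ℝ, 0 < ε → ε < 2 * Real.pi / width Ω →
        narrowLines Ω u v ε ∈ NyquistUniformUnions Ω) ∧
      Tendsto (fun ε : ℝ => pathDensity (narrowLines Ω u v ε)) (𝓝[>] 0)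
        (𝓝 (ENNReal.ofReal (width Ω / (2 * Real.pi))))) ∧
    ⨅ Q ∈ NyquistUniformUnions Ω, pathDensity Q = ENNReal.ofReal (width Ω / (2 * Real.pi)) := by
  have hpi : 0 < 2 * Real.pi := by positivity
  have hW0 := width_nonneg hne hcomp
  refine ⟨exists_isMinimalDirection hcomp, fun hW u v hu hv huv => ?_, ?_⟩
  · have key : ∀ ε : ℝ, 0 < ε → ε < 2 * Real.pi / width Ω →
        narrowLines Ω u v ε ∈ NyquistUniformUnions Ω ∧
        pathDensity (narrowLines Ω u v ε) = ENNReal.ofReal (2 * Real.pi / width Ω - ε)⁻¹ :=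
      fun ε h0 h1 => parallelLines_mem_nyquistUniformUnions hne hcomp hu hv huv (by linarith) (by
        rw [mul_sub, mul_div_cancel₀ _ hW.ne']
        nlinarith)
    refine ⟨fun ε h0 h1 => (key ε h0 h1).1, ?_⟩
    have hlim : Tendsto (fun ε : ℝ => ENNReal.ofReal (2 * Real.pi / width Ω - ε)⁻¹) (𝓝[>] 0)
        (𝓝 (ENNReal.ofReal (width Ω / (2 * Real.pi)))) := by
      have h : ContinuousAt (fun ε : ℝ => (2 * Real.pi / width Ω - ε)⁻¹) 0 := by
        refine ContinuousAt.inv₀ (by fun_prop) ?_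
        rw [sub_zero]; positivity
      have h' := (ENNReal.continuous_ofReal.continuousAt.comp h).tendsto
      rw [Function.comp_apply, sub_zero, inv_div] at h'
      exact h'.mono_left nhdsWithin_le_nhds
    refine hlim.congr' ?_
    filter_upwards [Ioo_mem_nhdsGT (show 0 < 2 * Real.pi / width Ω by positivity)] with ε hε
    exact (key ε hε.1 hε.2).2.symm
  · refine le_antisymm ?_ (le_iInf₂ fun Q hQ => width_div_le_pathDensity hne hcomp hconv hQ)
    obtain ⟨u, hu⟩ := exists_isMinimalDirection hcomp
    obtain ⟨v, hv, huv⟩ := exists_ne_zero_inner_eq_zero hu.1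
    -- Parametrising by the density `r ↓ width Ω / 2π`, with spacing `r⁻¹`, also covers width `0`,
    -- where `2 * π / width Ω` is `0` by convention.
    refine ge_of_tendsto ((ENNReal.continuous_ofReal.tendsto _).mono_left nhdsWithin_le_nhds :
      Tendsto ENNReal.ofReal (𝓝[>] (width Ω / (2 * Real.pi))) _) ?_
    filter_upwards [self_mem_nhdsWithin] with r hr
    have hr0 : 0 < r := lt_of_le_of_lt (by positivity) (mem_Ioi.1 hr)
    obtain ⟨h1, h2⟩ := parallelLines_mem_nyquistUniformUnions hne hcomp hu hv huv
      (inv_pos.2 hr0) (by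
        rw [← div_eq_mul_inv, div_lt_iff₀ hr0, mul_comm, ← div_lt_iff₀ hpi]
        exact hr)
    rw [inv_inv] at h2
    exact (iInf₂_le _ h1).trans h2.le
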